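/- Let $k$ be a commutative artinian ring, $n\ge 1$ an integer, and $(\mathcal C,\mathbb E,\mathfrak s)$ a $k$-linear $n$-exangulated category (in the sense of Herschend–Liu–Nakaoka) that is Krull–Schmidt and Ext-finite, i.e. every object is a finite direct sum of objects with local endomorphism rings, $\mathbb E\colon \mathcal C^{\mathrm{op}}\times\mathcal C\to k\text{-Mod}$ is $k$-bilinear, and every $\mathbb E(C,A)$ is a finitely generated $k$-module. Let $D=\operatorname{Hom}_k(-,\check k)$, where $\check k$ is the minimal injective cogenerator of the category $k\text{-mod}$ of finitely generated $k$-modules. A morphism $f\colon A\to B$ is $n$-projectively trivial if $\mathbb E(f,Z)=0$ for all $Z\in\mathcal C$, and $n$-injectively trivial if $\mathbb E(Z,f)=0$ for all $Z\in\mathcal C$. The stable category $\underline{\mathcal C}$ (resp. the costable category $\overline{\mathcal C}$) has the same objects as $\mathcal C$, and its morphisms are those of $\mathcal C$ modulo the $n$-projectively trivial (resp. $n$-injectively trivial) ones. Let $$\mathcal C_r=\{X\in\mathcal C\mid D\mathbb E(X,-)\colon\overline{\mathcal C}\to k\text{-mod is representable, i.e. } D\mathbb E(X,-)\cong\overline{\mathcal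 C}(-,X')\text{ for some }X'\},$$ $$\mathcal C_l=\{X\in\mathcal C\mid D\mathbb E(-,X)\colon\underline{\mathcal C}\to k\text{-mod is representable, i.e. } D\mathbb E(-,X)\cong\underline{\mathcal C}(X',-)\text{ for some }X'\}.$$ An object $P$ is projective if for every distinguished $n$-exangle $A_0\xrightarrow{\alpha_0}A_1\to\cdots\to A_n\xrightarrow{\alpha_n}A_{n+1}\dashrightarrow$ every morphism $P\to A_{n+1}$ factors through $\alpha_n$; injective objects are defined dually. A distinguished $n$-exangle as above is an Auslander–Reiten $n$-exangle if $\alpha_0$ is left almost split, $\alpha_n$ is right almost split and, when $n\ge 2$, $\alpha_1,\dots,\alpha_{n-1}$ lie in the Jacobson radical of $\mathcal C$; it starts at $A_0$ and ends at $A_{n+1}$. Let $X$ be an indecomposable object of $\mathcal C$. 1. If $X$ is non-projective, then $X\in\mathcal C_r$ if and only if there exists an Auslander–Reiten $n$-exangle ending at $X$. 2. If $X$ is non-injective, then $X\in\mathcal C_l$ if and only if there exists an Auslander–Reiten $n$-exangle starting at $X$. -/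

import Mathlib

open CategoryTheory CategoryTheory.Limits Opposite

universe w v u uk

/-! ### Complexes with fixed end terms -/

/-- An `(n+2)`-term complex `X₀ ⟶ X₁ ⟶ ⋯ ⟶ Xₙ₊₁` in `𝒞` with end terms `A` and `B`: a complex whose
components are zero outside the degrees `0, …, n+1`, together with identifications
`X₀ ≅ A` and `Xₙ₊₁ ≅ B`. (The identifications take the place of equalities of objects.) -/
structure NComplex (𝒞 : Type u) [Category.{v} 𝒞] [Preadditive 𝒞] (n : ℕ) (A B : 𝒞) where
  /-- the underlying complex -/
  K : CochainComplex 𝒞 ℤ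
  isZero_of_neg : ∀ i : ℤ, i < 0 → IsZero (K.X i)
  isZero_of_gt : ∀ i : ℤ, (n : ℤ) + 1 < i → IsZero (K.X i)
  /-- the zeroth term is `A` -/
  left : K.X 0 ≅ A
  /-- the last term is `B` -/
  right : K.X ((n : ℤ) + 1) ≅ B

namespace NComplex

variable {𝒞 : Type u} [Category.{v} 𝒞] [Preadditive 𝒞] {n : ℕ}

/-- The first differential `d₀ : A ⟶ X₁`. -/
def first {A B : 𝒞} (X : NComplex 𝒞 n A B) : A ⟶ X.K.X 1 := X.left.inv ≫ X.K.d 0 1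

/-- The last differential `dₙ : Xₙ ⟶ B`. -/
def last {A B : 𝒞} (X : NComplex 𝒞 n A B) : X.K.X (n : ℤ) ⟶ B :=
  X.K.d (n : ℤ) ((n : ℤ) + 1) ≫ X.right.hom

/-- The chain map `f` is of the form `(a, f₁, …, fₙ, b)`. -/
def HasEnds {A B A' B' : 𝒞} {X : NComplex 𝒞 n A B} {Y : NComplex 𝒞 n A' B'} (f : X.K ⟶ Y.K)
    (a : A ⟶ A') (b : B ⟶ B') : Prop :=
  f.f 0 ≫ Y.left.hom = X.left.hom ≫ a ∧
    f.f ((n : ℤ) + 1) ≫ Y.right.hom = X.right.hom ≫ b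

/-- Homotopy equivalence of complexes with the same end terms, through chain maps that are the
identity on both ends. -/
def HtpyEquiv {A B : 𝒞} (X Y : NComplex 𝒞 n A B) : Prop :=
  ∃ (f : X.K ⟶ Y.K) (g : Y.K ⟶ X.K),
    HasEnds (X := X) (Y := Y) f (𝟙 A) (𝟙 B) ∧ HasEnds (X := Y) (Y := X) g (𝟙 A) (𝟙 B) ∧
    Nonempty (Homotopy (f ≫ g) (𝟙 X.K)) ∧ Nonempty (Homotopy (g ≫ f) (𝟙 Y.K))

variable [HasBinaryBiproducts 𝒞]

/-- `M` is the mapping cone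
`X₁ ⟶ X₂ ⊞ Y₁ ⟶ ⋯ ⟶ Xₙ₊₁ ⊞ Yₙ ⟶ Yₙ₊₁` of a chain map `f : X ⟶ Y` whose zeroth component is an
identity. The differentials are `(-d₁, f₁)`, then `(x, y) ↦ (-d x, f x + d y)`, and finally
`(x, y) ↦ f x + d y`. -/
def IsMappingCone {A B D : 𝒞} (X : NComplex 𝒞 n A B) (Y : NComplex 𝒞 n A D) (f : X.K ⟶ Y.K)
    (M : NComplex 𝒞 n (X.K.X 1) D) : Prop :=
  ∃ φ : ∀ i j : ℤ, i + 1 = j → 1 ≤ i → i ≤ n → (M.K.X i ≅ X.K.X j ⊞ Y.K.X i),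
    (∀ h : 1 ≤ (n : ℤ),
      M.first ≫ (φ 1 2 rfl le_rfl h).hom = biprod.lift (-X.K.d 1 2) (f.f 1)) ∧
    (∀ (i j k : ℤ) (hij : i + 1 = j) (hjk : j + 1 = k) (hi : 1 ≤ i) (hj : j ≤ n),
      M.K.d i j ≫ (φ j k hjk (by omega) hj).hom =
        (φ i j hij hi (by omega)).hom ≫
          biprod.desc (biprod.lift (-X.K.d j k) (f.f j)) (biprod.lift 0 (Y.K.d i j))) ∧
    (∀ h : 1 ≤ (n : ℤ),
      M.last = (φ n (n + 1) rfl h le_rfl).hom ≫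
        biprod.desc (f.f ((n : ℤ) + 1) ≫ Y.right.hom) Y.last)

/-- `N` is the mapping cocone
`X₀ ⟶ X₁ ⊞ Y₀ ⟶ ⋯ ⟶ Xₙ ⊞ Yₙ₋₁ ⟶ Yₙ` of a chain map `f : X ⟶ Y` whose last component is an
identity. This is the mapping cone of `f` formed in the opposite category: the differentials are
`(d₀, f₀)`, then `(x, y) ↦ (d x, f x - d y)`, and finally `(x, y) ↦ f x - d y`. -/
def IsMappingCocone {A A' B : 𝒞} (X : NComplex 𝒞 n A B) (Y : NComplex 𝒞 n A' B) (f : X.K ⟶ Y.K)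
    (N : NComplex 𝒞 n A (Y.K.X (n : ℤ))) : Prop :=
  ∃ φ : ∀ i j : ℤ, i + 1 = j → 0 ≤ i → j ≤ n → (N.K.X j ≅ X.K.X j ⊞ Y.K.X i),
    (∀ h : 1 ≤ (n : ℤ),
      N.first ≫ (φ 0 1 rfl le_rfl h).hom = biprod.lift X.first (X.left.inv ≫ f.f 0)) ∧
    (∀ (i j k : ℤ) (hij : i + 1 = j) (hjk : j + 1 = k) (hi : 0 ≤ i) (hk : k ≤ n),
      N.K.d j k ≫ (φ j k hjk (by omega) hk).hom =
        (φ i j hij hi (by omega)).hom ≫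
          biprod.desc (biprod.lift (X.K.d j k) (f.f j)) (biprod.lift 0 (-Y.K.d i j))) ∧
    (∀ (i : ℤ) (hi : i + 1 = n) (h : 0 ≤ i),
      N.last = (φ i n hi h le_rfl).hom ≫ biprod.desc (f.f (n : ℤ)) (-Y.K.d i n))

end NComplex

/-! ### `n`-exangulated categories -/

/-- A bifunctor `𝔼 : 𝒞ᵒᵖ × 𝒞 ⥤ Mod k`, in curried form. -/
abbrev ExtFunctor (k : Type uk) [CommRing k] (𝒞 : Type u) [Category.{v} 𝒞] :=
  𝒞ᵒᵖ ⥤ 𝒞 ⥤ ModuleCat.{w} k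

namespace ExtFunctor

section

variable {k : Type uk} [CommRing k] {𝒞 : Type u} [Category.{v} 𝒞] (E : ExtFunctor.{w} k 𝒞)

/-- The module `𝔼(B, A)` of extensions. -/
abbrev Ext (B A : 𝒞) : ModuleCat.{w} k := (E.obj (op B)).obj A

/-- `𝔼(B, a) : 𝔼(B, A) → 𝔼(B, A')`, that is `δ ↦ a_* δ`. -/
def push {B A A' : 𝒞} (a : A ⟶ A') : E.Ext B A →ₗ[k] E.Ext B A' := ((E.obj (op B)).map a).hom

/-- `𝔼(b, A) : 𝔼(B, A) → 𝔼(B', A)`, that is `δ ↦ b^* δ`. -/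
def pull {B B' A : 𝒞} (b : B' ⟶ B) : E.Ext B A →ₗ[k] E.Ext B' A := ((E.map b.op).app A).hom

end

section

variable {k : Type uk} [CommRing k] {𝒞 : Type u} [Category.{v} 𝒞] [Preadditive 𝒞]

/-- The bifunctor `𝔼` is `k`-linear in each variable. -/
structure IsBilinear [Linear k 𝒞] (E : ExtFunctor.{w} k 𝒞) : Prop where
  push_add : ∀ {B A A' : 𝒞} (a a' : A ⟶ A'), E.push (B := B) (a + a') = E.push a + E.push a'
  push_smul : ∀ {B A A' : 𝒞} (r : k) (a : A ⟶ A'), E.push (B := B) (r • a) = r • E.push a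
  pull_add : ∀ {B B' A : 𝒞} (b b' : B' ⟶ B), E.pull (A := A) (b + b') = E.pull b + E.pull b'
  pull_smul : ∀ {B B' A : 𝒞} (r : k) (b : B' ⟶ B), E.pull (A := A) (r • b) = r • E.pull b

/-- `⟨X, δ⟩` is an `n`-exangle: `d₀_* δ = 0`, `dₙ^* δ = 0`, and for each object `T` the sequences
`𝒞(T, X₀) → ⋯ → 𝒞(T, Xₙ₊₁) → 𝔼(T, X₀)` and `𝒞(Xₙ₊₁, T) → ⋯ → 𝒞(X₀, T) → 𝔼(Xₙ₊₁, T)`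
are exact. -/
structure IsNExangle (E : ExtFunctor.{w} k 𝒞) {n : ℕ} {A B : 𝒞} (X : NComplex 𝒞 n A B)
    (δ : E.Ext B A) : Prop where
  push_first : E.push X.first δ = 0
  pull_last : E.pull X.last δ = 0
  exact_to : ∀ (T : 𝒞) (i j l : ℤ), i + 1 = j → j + 1 = l → 1 ≤ j → j ≤ n →
    ∀ g : T ⟶ X.K.X j, g ≫ X.K.d j l = 0 → ∃ h : T ⟶ X.K.X i, h ≫ X.K.d i j = g
  exact_to_last : ∀ (T : 𝒞) (g : T ⟶ B), E.pull g δ = 0 →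
    ∃ h : T ⟶ X.K.X (n : ℤ), h ≫ X.last = g
  exact_from : ∀ (T : 𝒞) (i j l : ℤ), i + 1 = j → j + 1 = l → 1 ≤ j → j ≤ n →
    ∀ g : X.K.X j ⟶ T, X.K.d i j ≫ g = 0 → ∃ h : X.K.X l ⟶ T, X.K.d j l ≫ h = g
  exact_from_first : ∀ (T : 𝒞) (g : A ⟶ T), E.push g δ = 0 →
    ∃ h : X.K.X 1 ⟶ T, X.first ≫ h = g

end

end ExtFunctor

/-- A `k`-linear `n`-exangulated category structure `(𝔼, 𝔰)` on the additive category `𝒞`. -/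
structure NExangulated (k : Type uk) [CommRing k] (𝒞 : Type u) [Category.{v} 𝒞] [Preadditive 𝒞]
    [HasBinaryBiproducts 𝒞] [Linear k 𝒞] (n : ℕ) where
  /-- the bifunctor of extensions -/
  E : ExtFunctor.{w} k 𝒞
  bilinear : E.IsBilinear
  /-- the class of complexes realizing a given extension -/
  s : ∀ {A B : 𝒞}, E.Ext B A → Set (NComplex 𝒞 n A B)
  /-- `𝔰(δ)` is a homotopy equivalence class. -/
  s_class : ∀ {A B : 𝒞} (δ : E.Ext B A),
    ∃ X : NComplex 𝒞 n A B, ∀ Y : NComplex 𝒞 n A B, Y ∈ s δ ↔ X.HtpyEquiv Y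
  /-- (R0): every morphism of extensions has a lift. -/
  exists_lift : ∀ {A B A' B' : 𝒞} (δ : E.Ext B A) (ρ : E.Ext B' A'),
    ∀ X ∈ s δ, ∀ Y ∈ s ρ, ∀ (a : A ⟶ A') (b : B ⟶ B'), E.push a δ = E.pull b ρ →
      ∃ f : X.K ⟶ Y.K, NComplex.HasEnds (X := X) (Y := Y) f a b
  /-- (R1): every realization is an `n`-exangle. -/
  isNExangle : ∀ {A B : 𝒞} (δ : E.Ext B A), ∀ X ∈ s δ, E.IsNExangle X δ
  /-- (R2): if `Z` is a zero object, then `𝔰(0)` for `0 ∈ 𝔼(Z, A)` is the class of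
  `A = A ⟶ 0 ⟶ ⋯ ⟶ 0`. -/
  trivial_left : ∀ {A Z : 𝒞}, IsZero Z → ∀ X : NComplex 𝒞 n A Z,
    IsIso (X.K.d 0 1) → (∀ i : ℤ, 2 ≤ i → IsZero (X.K.X i)) → X ∈ s (0 : E.Ext Z A)
  /-- (R2), dual: `𝔰(0)` for `0 ∈ 𝔼(A, Z)` is the class of `0 ⟶ ⋯ ⟶ 0 ⟶ A = A`. -/
  trivial_right : ∀ {A Z : 𝒞}, IsZero Z → ∀ X : NComplex 𝒞 n Z A,
    IsIso (X.K.d (n : ℤ) ((n : ℤ) + 1)) → (∀ i : ℤ, i < n → IsZero (X.K.X i)) →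
      X ∈ s (0 : E.Ext A Z)
  /-- (EA1): inflations (first differentials of distinguished `n`-exangles) compose. -/
  inflation_comp : ∀ {A B C : 𝒞} (f : A ⟶ B) (g : B ⟶ C),
    (∃ (D : 𝒞) (δ : E.Ext D A), ∃ X ∈ s δ, ∃ e : X.K.X 1 ≅ B, X.first ≫ e.hom = f) →
    (∃ (D : 𝒞) (δ : E.Ext D B), ∃ X ∈ s δ, ∃ e : X.K.X 1 ≅ C, X.first ≫ e.hom = g) →
    ∃ (D : 𝒞) (δ : E.Ext D A), ∃ X ∈ s δ, ∃ e : X.K.X 1 ≅ C, X.first ≫ e.hom = f ≫ g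
  /-- (EA1), dual: deflations (last differentials of distinguished `n`-exangles) compose. -/
  deflation_comp : ∀ {A B C : 𝒞} (f : A ⟶ B) (g : B ⟶ C),
    (∃ (D : 𝒞) (δ : E.Ext B D), ∃ X ∈ s δ, ∃ e : A ≅ X.K.X (n : ℤ), e.hom ≫ X.last = f) →
    (∃ (D : 𝒞) (δ : E.Ext C D), ∃ X ∈ s δ, ∃ e : B ≅ X.K.X (n : ℤ), e.hom ≫ X.last = g) →
    ∃ (D : 𝒞) (δ : E.Ext C D), ∃ X ∈ s δ, ∃ e : A ≅ X.K.X (n : ℤ), e.hom ≫ X.last = f ≫ g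
  /-- (EA2): `(id, c)` has a good lift. -/
  good_lift : ∀ {A C D : 𝒞} (ρ : E.Ext D A) (c : C ⟶ D),
    ∀ X ∈ s (E.pull c ρ), ∀ Y ∈ s ρ, ∃ f : X.K ⟶ Y.K,
      NComplex.HasEnds (X := X) (Y := Y) f (𝟙 A) c ∧
      ∃ M : NComplex 𝒞 n (X.K.X 1) D, X.IsMappingCone Y f M ∧ M ∈ s (E.push X.first ρ)
  /-- (EA2), dual: `(a, id)` has a good lift. -/
  good_lift_op : ∀ {A B C : 𝒞} (ρ : E.Ext C A) (a : A ⟶ B),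
    ∀ X ∈ s ρ, ∀ Y ∈ s (E.push a ρ), ∃ f : X.K ⟶ Y.K,
      NComplex.HasEnds (X := X) (Y := Y) f a (𝟙 C) ∧
      ∃ N : NComplex 𝒞 n A (Y.K.X (n : ℤ)), X.IsMappingCocone Y f N ∧ N ∈ s (E.pull Y.last ρ)

/-! ### General notions: Krull–Schmidt categories, radical, almost split morphisms -/

section

variable {𝒞 : Type u} [Category.{v} 𝒞]

/-- `f` is left almost split: it is not a split monomorphism, and every morphism from its source
that is not a split monomorphism factors through it. -/
def LeftAlmostSplit {A B : 𝒞} (f : A ⟶ B) : Prop :=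
  ¬ IsSplitMono f ∧ ∀ (T : 𝒞) (g : A ⟶ T), ¬ IsSplitMono g → ∃ h : B ⟶ T, f ≫ h = g

/-- `f` is right almost split: it is not a split epimorphism, and every morphism to its target
that is not a split epimorphism factors through it. -/
def RightAlmostSplit {A B : 𝒞} (f : A ⟶ B) : Prop :=
  ¬ IsSplitEpi f ∧ ∀ (T : 𝒞) (g : T ⟶ B), ¬ IsSplitEpi g → ∃ h : T ⟶ A, h ≫ f = g

variable [Preadditive 𝒞]

/-- `f` lies in the Jacobson radical of the category. -/
def InRadical {A B : 𝒞} (f : A ⟶ B) : Prop := ∀ g : B ⟶ A, IsIso (𝟙 A - f ≫ g)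

variable (𝒞) in
/-- `𝒞` is Krull–Schmidt: every object is a finite direct sum of objects with local endomorphism
rings. -/
def IsKrullSchmidt : Prop :=
  ∀ X : 𝒞, ∃ (m : ℕ) (Y : Fin m → 𝒞) (b : Bicone Y),
    (∀ i, IsLocalRing (End (Y i))) ∧ Nonempty b.IsBilimit ∧ Nonempty (X ≅ b.pt)

end

/-! ### The minimal injective cogenerator -/

section

variable (k : Type uk) [CommRing k]

/-- `J` is an injective cogenerator of the category of finitely generated `k`-modules. -/
structure IsInjectiveCogenerator (J : Type uk) [AddCommGroup J] [Module k J] : Prop where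
  finite : Module.Finite k J
  injective : ∀ (M N : Type uk) [AddCommGroup M] [AddCommGroup N] [Module k M] [Module k N]
    [Module.Finite k M] [Module.Finite k N] (f : M →ₗ[k] N), Function.Injective f →
    ∀ g : M →ₗ[k] J, ∃ h : N →ₗ[k] J, h ∘ₗ f = g
  cogenerator : ∀ (M : Type uk) [AddCommGroup M] [Module k M] [Module.Finite k M] (m : M), m ≠ 0 →
    ∃ φ : M →ₗ[k] J, φ m ≠ 0

/-- `J` is the minimal injective cogenerator (unique up to isomorphism) of the category of finitely
generated `k`-modules: no proper submodule of it is an injective cogenerator. -/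
structure IsMinimalInjectiveCogenerator (J : Type uk) [AddCommGroup J] [Module k J] : Prop extends
    IsInjectiveCogenerator k J where
  minimal : ∀ N : Submodule k J, IsInjectiveCogenerator k N → N = ⊤

end

/-! ### Representable `k`-linear functors -/

section

variable {k : Type uk} [CommRing k] {𝒟 : Type u} [Category.{v} 𝒟] [Preadditive 𝒟] [Linear k 𝒟]

/-- The contravariant functor `F` is isomorphic to `𝒟(-, X)` for some `X`, as a functor to
`k`-modules. -/
def IsContraRepresentable (F : 𝒟ᵒᵖ ⥤ ModuleCat.{w} k) : Prop :=
  ∃ (X : 𝒟) (e : ∀ Y : 𝒟, (Y ⟶ X) ≃ₗ[k] F.obj (op Y)),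
    ∀ {Y Z : 𝒟} (f : Y ⟶ Z) (g : Z ⟶ X), e Y (f ≫ g) = F.map f.op (e Z g)

/-- The covariant functor `F` is isomorphic to `𝒟(X, -)` for some `X`, as a functor to
`k`-modules. -/
def IsCoRepresentable (F : 𝒟 ⥤ ModuleCat.{w} k) : Prop :=
  ∃ (X : 𝒟) (e : ∀ Y : 𝒟, (X ⟶ Y) ≃ₗ[k] F.obj Y),
    ∀ {Y Z : 𝒟} (g : X ⟶ Y) (f : Y ⟶ Z), e Z (g ≫ f) = F.map f (e Y g)

end

namespace NExangulated

variable {k : Type uk} [CommRing k] {𝒞 : Type u} [Category.{v} 𝒞] [Preadditive 𝒞]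
  [HasBinaryBiproducts 𝒞] [Linear k 𝒞] {n : ℕ} (T : NExangulated.{w} k 𝒞 n)

/-- `𝔼(B, A)` is a finitely generated `k`-module for all `A` and `B`. -/
def IsExtFinite : Prop := ∀ A B : 𝒞, Module.Finite k (T.E.Ext B A)

/-- `P` is projective: for each distinguished `n`-exangle, morphisms from `P` to the last term factor
through the last differential. -/
def IsProjective (P : 𝒞) : Prop :=
  ∀ (A B : 𝒞) (δ : T.E.Ext B A), ∀ X ∈ T.s δ, ∀ c : P ⟶ B,
    ∃ b : P ⟶ X.K.X (n : ℤ), b ≫ X.last = c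

/-- `I` is injective: for each distinguished `n`-exangle, morphisms from the first term to `I` factor
through the first differential. -/
def IsInjective (I : 𝒞) : Prop :=
  ∀ (A B : 𝒞) (δ : T.E.Ext B A), ∀ X ∈ T.s δ, ∀ c : A ⟶ I,
    ∃ b : X.K.X 1 ⟶ I, X.first ≫ b = c

/-- `⟨X, δ⟩` is an Auslander–Reiten `n`-exangle. -/
structure IsAuslanderReiten {A B : 𝒞} (X : NComplex 𝒞 n A B) (δ : T.E.Ext B A) : Prop where
  distinguished : X ∈ T.s δ
  left_almost_split : LeftAlmostSplit X.first
  right_almost_split : RightAlmostSplit X.last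
  radical : ∀ i j : ℤ, i + 1 = j → 1 ≤ i → j ≤ n → InRadical (X.K.d i j)

/-! #### Stable and costable categories -/

/-- `f` is `n`-projectively trivial: `𝔼(f, Z) = 0` for all `Z`. -/
def ProjTrivial {A B : 𝒞} (f : A ⟶ B) : Prop := ∀ Z : 𝒞, T.E.pull (A := Z) f = 0

/-- `f` is `n`-injectively trivial: `𝔼(Z, f) = 0` for all `Z`. -/
def InjTrivial {A B : 𝒞} (f : A ⟶ B) : Prop := ∀ Z : 𝒞, T.E.push (B := Z) f = 0

/-- Congruence modulo the `n`-projectively trivial morphisms. -/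
def projRel : HomRel 𝒞 := fun _ _ f g => T.ProjTrivial (f - g)

/-- Congruence modulo the `n`-injectively trivial morphisms. -/
def injRel : HomRel 𝒞 := fun _ _ f g => T.InjTrivial (f - g)

lemma pull_sub {A B Z : 𝒞} (f g : A ⟶ B) :
    T.E.pull (A := Z) (f - g) = T.E.pull f - T.E.pull g := by
  rw [eq_sub_iff_add_eq, ← T.bilinear.pull_add, sub_add_cancel]

lemma push_sub {A B Z : 𝒞} (f g : A ⟶ B) :
    T.E.push (B := Z) (f - g) = T.E.push f - T.E.push g := by
  rw [eq_sub_iff_add_eq, ← T.bilinear.push_add, sub_add_cancel]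

lemma pull_comp {A B C Z : 𝒞} (f : A ⟶ B) (g : B ⟶ C) :
    T.E.pull (A := Z) (f ≫ g) = T.E.pull f ∘ₗ T.E.pull g := by
  ext x; simp [ExtFunctor.pull]

lemma push_comp {A B C Z : 𝒞} (f : A ⟶ B) (g : B ⟶ C) :
    T.E.push (B := Z) (f ≫ g) = T.E.push g ∘ₗ T.E.push f := by
  ext x; simp [ExtFunctor.push]

lemma pull_id {A Z : 𝒞} : T.E.pull (A := Z) (𝟙 A) = LinearMap.id := by
  ext x; simp [ExtFunctor.pull]

lemma push_id {A Z : 𝒞} : T.E.push (B := Z) (𝟙 A) = LinearMap.id := by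
  ext x; simp [ExtFunctor.push]

lemma projRel_iff {A B : 𝒞} (f g : A ⟶ B) :
    T.projRel f g ↔ ∀ Z : 𝒞, T.E.pull (A := Z) f = T.E.pull g := by
  simp [projRel, ProjTrivial, pull_sub, sub_eq_zero]

lemma injRel_iff {A B : 𝒞} (f g : A ⟶ B) :
    T.injRel f g ↔ ∀ Z : 𝒞, T.E.push (B := Z) f = T.E.push g := by
  simp [injRel, InjTrivial, push_sub, sub_eq_zero]

instance : Congruence T.projRel where
  equivalence :=
    { refl := fun f => by simp [projRel_iff]
      symm := fun h => by rw [projRel_iff] at *; exact fun Z => (h Z).symm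
      trans := fun h h' => by rw [projRel_iff] at *; exact fun Z => (h Z).trans (h' Z) }
  comp_left := fun f _ _ h => by
    rw [projRel_iff] at *; intro Z; rw [pull_comp, pull_comp, h Z]
  comp_right := fun g h => by
    rw [projRel_iff] at *; intro Z; rw [pull_comp, pull_comp, h Z]

instance : Congruence T.injRel where
  equivalence :=
    { refl := fun f => by simp [injRel_iff]
      symm := fun h => by rw [injRel_iff] at *; exact fun Z => (h Z).symm
      trans := fun h h' => by rw [injRel_iff] at *; exact fun Z => (h Z).trans (h' Z) }
  comp_left := fun f _ _ h => by
    rw [injRel_iff] at *; intro Z; rw [push_comp, push_comp, h Z]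
  comp_right := fun g h => by
    rw [injRel_iff] at *; intro Z; rw [push_comp, push_comp, h Z]

/-- The stable category: morphisms are taken modulo the `n`-projectively trivial ones. -/
abbrev Stable := CategoryTheory.Quotient T.projRel

/-- The costable category: morphisms are taken modulo the `n`-injectively trivial ones. -/
abbrev Costable := CategoryTheory.Quotient T.injRel

lemma projRel_add ⦃A B : 𝒞⦄ (f₁ f₂ g₁ g₂ : A ⟶ B) (hf : T.projRel f₁ f₂) (hg : T.projRel g₁ g₂) :
    T.projRel (f₁ + g₁) (f₂ + g₂) := by
  rw [projRel_iff] at *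
  intro Z
  rw [T.bilinear.pull_add, T.bilinear.pull_add, hf Z, hg Z]

lemma injRel_add ⦃A B : 𝒞⦄ (f₁ f₂ g₁ g₂ : A ⟶ B) (hf : T.injRel f₁ f₂) (hg : T.injRel g₁ g₂) :
    T.injRel (f₁ + g₁) (f₂ + g₂) := by
  rw [injRel_iff] at *
  intro Z
  rw [T.bilinear.push_add, T.bilinear.push_add, hf Z, hg Z]

lemma projRel_smul (r : k) ⦃A B : 𝒞⦄ (f g : A ⟶ B) (h : T.projRel f g) :
    T.projRel (r • f) (r • g) := by
  rw [projRel_iff] at *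
  intro Z
  rw [T.bilinear.pull_smul, T.bilinear.pull_smul, h Z]

lemma injRel_smul (r : k) ⦃A B : 𝒞⦄ (f g : A ⟶ B) (h : T.injRel f g) :
    T.injRel (r • f) (r • g) := by
  rw [injRel_iff] at *
  intro Z
  rw [T.bilinear.push_smul, T.bilinear.push_smul, h Z]

instance : Preadditive T.Stable := Quotient.preadditive _ T.projRel_add

instance : Preadditive T.Costable := Quotient.preadditive _ T.injRel_add

instance : (Quotient.functor T.projRel).Additive := Quotient.functor_additive _ T.projRel_add

instance : (Quotient.functor T.injRel).Additive := Quotient.functor_additive _ T.injRel_add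

instance : Linear k T.Stable := Quotient.linear k _ T.projRel_smul

instance : Linear k T.Costable := Quotient.linear k _ T.injRel_smul

/-! #### The functors `D𝔼(X, -)` and `D𝔼(-, X)` and the subcategories `𝒞_r` and `𝒞_l` -/

section

variable (J : Type uk) [AddCommGroup J] [Module k J]

/-- The functor `Y ↦ Hom_k(𝔼(X, Y), J)` on `𝒞`, contravariant in `Y`. -/
def dualExtFrom (X : 𝒞) : 𝒞 ⥤ (ModuleCat.{max w uk} k)ᵒᵖ where
  obj Y := op (ModuleCat.of k (T.E.Ext X Y →ₗ[k] J))
  map f := (ModuleCat.ofHom (LinearMap.lcomp k J (T.E.push f))).op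
  map_id Y := by
    apply Quiver.Hom.unop_inj; ext φ x; simp [push_id]
  map_comp f g := by
    apply Quiver.Hom.unop_inj; ext φ x; simp [push_comp]

/-- The functor `Y ↦ Hom_k(𝔼(Y, X), J)` on `𝒞`, covariant in `Y`. -/
def dualExtTo (X : 𝒞) : 𝒞 ⥤ ModuleCat.{max w uk} k where
  obj Y := ModuleCat.of k (T.E.Ext Y X →ₗ[k] J)
  map f := ModuleCat.ofHom (LinearMap.lcomp k J (T.E.pull f))
  map_id Y := by ext φ x; simp [pull_id]
  map_comp f g := by ext φ x; simp [pull_comp]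

/-- The contravariant functor `D𝔼(X, -)` from the costable category to `k`-modules. -/
def costableDualExt (X : 𝒞) : T.Costableᵒᵖ ⥤ ModuleCat.{max w uk} k :=
  (CategoryTheory.Quotient.lift T.injRel (T.dualExtFrom J X) (by
    intro Y Z f g h
    rw [injRel_iff] at h
    simp only [dualExtFrom, h X])).leftOp

/-- The covariant functor `D𝔼(-, X)` from the stable category to `k`-modules. -/
def stableDualExt (X : 𝒞) : T.Stable ⥤ ModuleCat.{max w uk} k :=
  CategoryTheory.Quotient.lift T.projRel (T.dualExtTo J X) (by
    intro Y Z f g h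
    rw [projRel_iff] at h
    simp only [dualExtTo, h X])

/-- `X ∈ 𝒞_r`: the functor `D𝔼(X, -)` on the costable category is representable. -/
def MemCr (X : 𝒞) : Prop := IsContraRepresentable (T.costableDualExt J X)

/-- `X ∈ 𝒞_l`: the functor `D𝔼(-, X)` on the stable category is representable. -/
def MemCl (X : 𝒞) : Prop := IsCoRepresentable (T.stableDualExt J X)

end

end NExangulated

/-! Both conditions on `X` concern a single extension. By Yoneda, `X ∈ 𝒞_r` means that some
functional `φ` on `𝔼(X, A)` makes the pairing `(f, μ) ↦ φ (f_* μ)` identify `D𝔼(X, Y)` with the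
costable morphisms `Y ⟶ A` (`memCr_iff`). By exactness, Auslander–Reiten `n`-exangles correspond to
nonzero `δ ∈ 𝔼(X, A)` killed by pushing along non-split monos and pulling along non-split epis
(`ExactExt.AlmostSplit`); the radical condition is met by a realization with the fewest summands.

From `δ` to `φ`: take `φ` with `φ δ ≠ 0`. Every nonzero extension of `X` pushes to `δ`, and every
nonzero extension by `A` pulls back to `δ`. Hence the functionals `φ ∘ f_*` separate the points of
`𝔼(X, Y)`, and `φ ∘ f_* = 0` only for injectively trivial `f`. A separating submodule of a dual is
everything (`eq_top_of_separates`), because dualizing into the minimal cogenerator does not increase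
length.

From `φ` to `δ`: representability makes `𝔼(X, A)` nonzero, and an element with minimal `End X`-orbit
is killed by the non-split endomorphisms of `X`. Injectivity of `J` shows that an extension by `A`
is detected by its pullbacks to `X`, so all non-split epis kill the element. Projecting to a local
summand of `A` gives `δ`.

The argument uses only the self-dual axioms `ExactExt`, so the second half of the theorem is the
first half in the opposite category. -/

/-! ### Injective cogenerators -/

namespace IsInjectiveCogenerator

variable {k : Type uk} [CommRing k] {J : Type uk} [AddCommGroup J] [Module k J]

/-- The axioms on `J` test modules in `Type uk` only. A finitely generated module in any universe is
isomorphic to a quotient of some `k^n`, which lives there. -/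
lemma exists_apply_ne_zero (hJ : IsInjectiveCogenerator k J) {M : Type w} [AddCommGroup M]
    [Module k M] [Module.Finite k M] {m : M} (hm : m ≠ 0) : ∃ φ : M →ₗ[k] J, φ m ≠ 0 := by
  obtain ⟨n, f, hf⟩ := Module.Finite.exists_fin' k M
  let e : ((Fin n → k) ⧸ LinearMap.ker f) ≃ₗ[k] M := f.quotKerEquivOfSurjective hf
  obtain ⟨φ, hφ⟩ := hJ.cogenerator _ (e.symm m) (by simpa using hm)
  exact ⟨φ ∘ₗ e.symm.toLinearMap, hφ⟩

/-- A direct summand of an injective cogenerator that contains elements with each maximal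
annihilator is an injective cogenerator. -/
lemma of_retract (hJ : IsInjectiveCogenerator k J) [IsNoetherianRing k] (K : Submodule k J)
    (p : J →ₗ[k] K) (hp : ∀ x : K, p x = x)
    (hK : ∀ I : Ideal k, I.IsMaximal → ∃ w : K, w ≠ 0 ∧ ∀ r ∈ I, r • w = 0) :
    IsInjectiveCogenerator k K := by
  have := hJ.finite
  have hinj : ∀ (M N : Type uk) [AddCommGroup M] [AddCommGroup N] [Module k M] [Module k N]
      [Module.Finite k M] [Module.Finite k N] (f : M →ₗ[k] N), Function.Injective f →
      ∀ g : M →ₗ[k] K, ∃ h : N →ₗ[k] K, h ∘ₗ f = g := by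
    intro M N _ _ _ _ _ _ f hf g
    obtain ⟨h, hh⟩ := hJ.injective M N f hf (K.subtype ∘ₗ g)
    refine ⟨p ∘ₗ h, ?_⟩
    ext x
    have := LinearMap.congr_fun hh x
    simp only [LinearMap.comp_apply, Submodule.subtype_apply] at this ⊢
    rw [this, hp]
  refine ⟨inferInstance, hinj, ?_⟩
  intro M _ _ _ m hm
  let t : k →ₗ[k] M := LinearMap.toSpanSingleton k M m
  have ht : LinearMap.ker t ≠ ⊤ := by
    intro h
    apply hm
    have : (1 : k) ∈ LinearMap.ker t := h ▸ Submodule.mem_top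
    simpa [t] using this
  obtain ⟨I, hI, hle⟩ := Ideal.exists_le_maximal _ ht
  obtain ⟨w, hw, hIw⟩ := hK I hI
  -- The annihilator of `m` lies in `I`, which kills `w`, so `m ↦ w` is well defined on `k m`;
  -- injectivity extends it to `M`.
  let g : (k ⧸ LinearMap.ker t) →ₗ[k] K :=
    (LinearMap.ker t).liftQ (LinearMap.toSpanSingleton k K w) (fun r hr => by
      simpa using hIw r (hle hr))
  let f : (k ⧸ LinearMap.ker t) →ₗ[k] M := (LinearMap.ker t).liftQ t le_rfl
  obtain ⟨h, hh⟩ := hinj _ _ f (LinearMap.ker_eq_bot.1 (Submodule.ker_liftQ_eq_bot' _ _ rfl)) g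
  refine ⟨h, ?_⟩
  have := LinearMap.congr_fun hh ((LinearMap.ker t).mkQ 1)
  simp only [LinearMap.comp_apply, f, g, Submodule.mkQ_apply, Submodule.liftQ_apply] at this
  simp only [t, LinearMap.toSpanSingleton_apply, one_smul] at this
  rwa [this]

lemma exists_extension (hJ : IsInjectiveCogenerator k J) {M N : Type w} [AddCommGroup M]
    [AddCommGroup N] [Module k M] [Module k N] [Module.Finite k M] [Module.Finite k N]
    {f : M →ₗ[k] N} (hf : Function.Injective f) (g : M →ₗ[k] J) :
    ∃ h : N →ₗ[k] J, ∀ m, h (f m) = g m := by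
  obtain ⟨m, p, hp⟩ := Module.Finite.exists_fin' k M
  obtain ⟨n, q, hq⟩ := Module.Finite.exists_fin' k N
  let eM := p.quotKerEquivOfSurjective hp
  let eN := q.quotKerEquivOfSurjective hq
  obtain ⟨h, hh⟩ := hJ.injective _ _ (eN.symm.toLinearMap ∘ₗ f ∘ₗ eM.toLinearMap)
    (eN.symm.injective.comp (hf.comp eM.injective)) (g ∘ₗ eM.toLinearMap)
  refine ⟨h ∘ₗ eN.symm.toLinearMap, fun x => ?_⟩
  simpa using LinearMap.congr_fun hh (eM.symm x)

/-- As `I` is maximal and `z ≠ 0`, the module `k z` is `k ⧸ I`, so `z ↦ y` is well defined on it and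
extends to `J` by injectivity. -/
lemma exists_endo (hJ : IsInjectiveCogenerator k J) {I : Ideal k} (hI : I.IsMaximal) {y z : J}
    (hz : z ≠ 0) (hIz : ∀ r ∈ I, r • z = 0) (hIy : ∀ r ∈ I, r • y = 0) :
    ∃ h : J →ₗ[k] J, h z = y := by
  have := hJ.finite
  have hker : LinearMap.ker (LinearMap.toSpanSingleton k J z) = I := by
    refine (hI.eq_of_le ?_ (fun r hr => by simpa using hIz r hr)).symm
    intro h
    apply hz
    have : (1 : k) ∈ LinearMap.ker (LinearMap.toSpanSingleton k J z) := h ▸ Submodule.mem_top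
    simpa using this
  let f : (k ⧸ I) →ₗ[k] J := Submodule.liftQ I (LinearMap.toSpanSingleton k J z) hker.ge
  let g : (k ⧸ I) →ₗ[k] J := Submodule.liftQ I (LinearMap.toSpanSingleton k J y)
    (fun r hr => by simpa using hIy r hr)
  obtain ⟨h, hh⟩ := hJ.injective _ _ f
    (LinearMap.ker_eq_bot.1 (Submodule.ker_liftQ_eq_bot' _ _ hker.symm)) g
  refine ⟨h, ?_⟩
  have := LinearMap.congr_fun hh (Submodule.mkQ I 1)
  simp only [LinearMap.comp_apply, f, g, Submodule.mkQ_apply, Submodule.liftQ_apply] at this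
  simpa only [LinearMap.toSpanSingleton_apply, one_smul] using this

end IsInjectiveCogenerator

/-- Multiplication by `r` is the identity on elements killed by `I` and zero on those killed by
another maximal ideal. It exists because there are finitely many maximal ideals and the prime `I`
does not contain the intersection of the others. -/
lemma Ideal.exists_sub_one_mem_of_isMaximal {k : Type uk} [CommRing k] [IsArtinianRing k]
    (I : Ideal k) (hI : I.IsMaximal) :
    ∃ r : k, r - 1 ∈ I ∧ ∀ I' : Ideal k, I'.IsMaximal → I' ≠ I → r ∈ I' := by
  classical
  have hfin : {I' : Ideal k | I'.IsMaximal ∧ I' ≠ I}.Finite :=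
    (IsArtinianRing.setOfPred_isMaximal_finite k).subset fun _ h => h.1
  have hnle : ¬ hfin.toFinset.inf id ≤ I := by
    rw [hI.isPrime.inf_le']
    rintro ⟨I', hI', hle⟩
    rw [Set.Finite.mem_toFinset] at hI'
    exact hI'.2 (hI'.1.eq_of_le hI.ne_top hle)
  obtain ⟨r, hr, hrI⟩ := SetLike.not_le_iff_exists.1 hnle
  obtain ⟨s, i, hi, hs⟩ := hI.exists_inv hrI
  refine ⟨s * r, ?_, fun I' h1 h2 => ?_⟩
  · have : s * r - 1 = -i := by rw [← hs]; ring
    rw [this]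
    exact I.neg_mem hi
  · exact I'.mul_mem_left _ ((Finset.inf_le (f := id)
      (hfin.mem_toFinset.2 ⟨h1, h2⟩) : _ ≤ I') hr)

/-! ### Lengths of duals into the minimal injective cogenerator -/

namespace IsMinimalInjectiveCogenerator

variable {k : Type uk} [CommRing k] [IsArtinianRing k] {J : Type uk} [AddCommGroup J] [Module k J]

/-- The part of the socle of `J` that belongs to a maximal ideal is simple. -/
lemma mem_span_singleton (hJ : IsMinimalInjectiveCogenerator k J) {I : Ideal k} (hI : I.IsMaximal)
    {x y : J} (hx : x ≠ 0) (hIx : ∀ r ∈ I, r • x = 0) (hIy : ∀ r ∈ I, r • y = 0) :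
    y ∈ Submodule.span k {x} := by
  by_contra hy
  have hJ' := hJ.toIsInjectiveCogenerator
  have := hJ.finite
  obtain ⟨φ, hφ⟩ := hJ.cogenerator (J ⧸ Submodule.span k {x}) (Submodule.mkQ _ y)
    (by simpa using hy)
  obtain ⟨h, hh⟩ := hJ'.exists_endo hI (y := y) hφ
    (fun r hr => by rw [← map_smul, ← map_smul, hIy r hr]; simp) hIy
  obtain ⟨r, hr, hr'⟩ := Ideal.exists_sub_one_mem_of_isMaximal I hI
  -- `e` kills `x` and fixes `y`; the factor `r` makes it kill the elements annihilated by any other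
  -- maximal ideal.
  let e : Module.End k J := r • (h ∘ₗ φ ∘ₗ Submodule.mkQ (Submodule.span k {x}))
  have hex : e x = 0 := by
    have : (Submodule.span k {x}).mkQ x = 0 := by
      simp [Submodule.mem_span_singleton_self]
    simp only [e, LinearMap.smul_apply, LinearMap.comp_apply, this, map_zero, smul_zero]
  have hey : e y = y := by
    simp only [e, LinearMap.smul_apply, LinearMap.comp_apply, hh]
    have := hIy _ hr
    rwa [sub_smul, one_smul, sub_eq_zero] at this
  have hew : ∀ w : J, r • w = 0 → e w = 0 := by
    intro w hw
    simp only [e, LinearMap.smul_apply, ← map_smul, hw, map_zero]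
  -- By Fitting, `ker (e ^ N)` is a direct summand of `J`. It contains `x` for the ideal `I` and a
  -- nonzero element for every other maximal ideal, so it is an injective cogenerator. Minimality
  -- makes it all of `J`, although `e ^ N` fixes `y ≠ 0`.
  obtain ⟨N, hN, hN1⟩ := ((LinearMap.eventually_isCompl_ker_pow_range_pow e).and
    (Filter.eventually_ge_atTop 1)).exists
  have hsub : LinearMap.ker e ≤ LinearMap.ker (e ^ N) := by
    intro w hw
    obtain ⟨N, rfl⟩ := Nat.exists_eq_add_of_le' hN1
    rw [LinearMap.mem_ker] at hw ⊢
    rw [pow_succ, Module.End.mul_apply, hw, map_zero]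
  have htop := hJ.minimal (LinearMap.ker (e ^ N)) (hJ'.of_retract _
    (Submodule.projectionOnto _ _ hN)
    (fun w => Submodule.projectionOnto_apply_left hN w) (by
      intro I' hI'
      by_cases hII : I' = I
      · subst hII
        refine ⟨⟨x, hsub hex⟩, ?_, fun r hr => ?_⟩
        · simpa using hx
        · exact Subtype.ext (hIx r hr)
      · obtain ⟨ψ, hψ⟩ := hJ.cogenerator (k ⧸ I') (Submodule.mkQ I' 1) (by
          rw [Submodule.mkQ_apply, Ne, Submodule.Quotient.mk_eq_zero]
          exact (Ideal.ne_top_iff_one I').1 hI'.ne_top)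
        have hz : ∀ s ∈ I', s • ψ (Submodule.mkQ I' 1) = 0 := fun s hs => by
          rw [← map_smul, ← map_smul, smul_eq_mul, mul_one]
          have : Submodule.mkQ I' s = 0 := (Submodule.Quotient.mk_eq_zero _).2 hs
          rw [this, map_zero]
        refine ⟨⟨ψ (Submodule.mkQ I' 1), hsub (hew _ (hz r (hr' I' hI' hII)))⟩, ?_, fun s hs => ?_⟩
        · simpa using hψ
        · exact Subtype.ext (hz s hs)))
  have hpow : ∀ N : ℕ, (e ^ N) y = y := by
    intro N
    induction N with
    | zero => simp
    | succ N ih => rw [pow_succ, Module.End.mul_apply, hey, ih]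
  have hyN : y ∈ LinearMap.ker (e ^ N) := htop ▸ Submodule.mem_top
  rw [LinearMap.mem_ker, hpow] at hyN
  exact hy (hyN ▸ Submodule.zero_mem _)

/-- A functional on a simple module is determined by its value at one nonzero `s`. These values are
killed by the annihilator of `s`, a maximal ideal, so they are all multiples of any nonzero one
among them. -/
lemma length_dual_simple_le (hJ : IsMinimalInjectiveCogenerator k J) (S : Type w) [AddCommGroup S]
    [Module k S] [IsSimpleModule k S] : Module.length k (S →ₗ[k] J) ≤ 1 := by
  rcases subsingleton_or_nontrivial (S →ₗ[k] J) with h | h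
  · rw [Module.length_eq_zero]; exact zero_le_one
  · suffices IsSimpleModule k (S →ₗ[k] J) from (Module.length_eq_one k _).le
    rw [isSimpleModule_iff_toSpanSingleton_surjective]
    refine ⟨h, fun f hf g => ?_⟩
    obtain ⟨s, hs⟩ : ∃ s, f s ≠ 0 := by
      by_contra! hc
      exact hf (LinearMap.ext hc)
    have hs0 : s ≠ 0 := fun h => hs (by rw [h, map_zero])
    have hker : ∀ q : S →ₗ[k] J, ∀ r ∈ LinearMap.ker (LinearMap.toSpanSingleton k S s),
        r • q s = 0 := fun q r hr => by
      rw [LinearMap.mem_ker, LinearMap.toSpanSingleton_apply] at hr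
      rw [← map_smul, hr, map_zero]
    obtain ⟨r, hr⟩ := Submodule.mem_span_singleton.1 (hJ.mem_span_singleton
      (IsSimpleModule.ker_toSpanSingleton_isMaximal k hs0) hs (hker f) (hker g))
    refine ⟨r, ?_⟩
    ext t
    obtain ⟨a, rfl⟩ := IsSimpleModule.toSpanSingleton_surjective k hs0 t
    simp only [LinearMap.toSpanSingleton_apply, LinearMap.smul_apply, map_smul, ← hr]

/-- Induction along a composition series. Only left exactness of `Hom(-, J)` enters: functionals on
`M` that vanish on `N` come from the simple quotient `M ⧸ N`. -/
lemma length_dual_le (hJ : IsMinimalInjectiveCogenerator k J) {M : Type w} [AddCommGroup M]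
    [Module k M] (hM : IsFiniteLength k M) :
    Module.length k (M →ₗ[k] J) ≤ Module.length k M := by
  induction hM with
  | of_subsingleton => simp [Module.length_eq_zero]
  | @of_simple_quotient M _ _ N _ hN ih =>
    have h1 : Module.length k M = Module.length k N + Module.length k (M ⧸ N) :=
      Module.length_eq_add_of_exact N.subtype N.mkQ N.injective_subtype N.mkQ_surjective
        (LinearMap.exact_subtype_mkQ N)
    let ρ : (M →ₗ[k] J) →ₗ[k] (N →ₗ[k] J) := LinearMap.lcomp k J N.subtype
    have h2 := Module.length_eq_add_of_exact (LinearMap.ker ρ).subtype ρ.rangeRestrict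
      (LinearMap.ker ρ).injective_subtype ρ.surjective_rangeRestrict
      (by rw [LinearMap.exact_iff, LinearMap.ker_rangeRestrict, Submodule.range_subtype])
    have h3 : Module.length k (LinearMap.ker ρ) ≤ 1 := by
      refine le_trans ?_ (hJ.length_dual_simple_le (M ⧸ N))
      let τ : ((M ⧸ N) →ₗ[k] J) →ₗ[k] (M →ₗ[k] J) := LinearMap.lcomp k J N.mkQ
      have hle : LinearMap.ker ρ ≤ LinearMap.range τ := by
        intro f hf
        refine ⟨N.liftQ f fun x hx => ?_, ?_⟩
        · exact LinearMap.congr_fun hf (⟨x, hx⟩ : N)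
        · ext x; rfl
      exact (Module.length_le_of_injective (Submodule.inclusion hle)
        (Submodule.inclusion_injective hle)).trans
        (Module.length_le_of_surjective τ.rangeRestrict τ.surjective_rangeRestrict)
    have h4 : Module.length k (LinearMap.range ρ) ≤ Module.length k N :=
      (Module.length_le_of_injective (LinearMap.range ρ).subtype
        (LinearMap.range ρ).injective_subtype).trans ih
    rw [h2, h1, Module.length_eq_one k (M ⧸ N), add_comm]
    exact add_le_add h4 h3

/-- A submodule of the dual of a finitely generated module that separates points is everything. -/
lemma eq_top_of_separates (hJ : IsMinimalInjectiveCogenerator k J) {M : Type w} [AddCommGroup M]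
    [Module k M] [Module.Finite k M] (H : Submodule k (M →ₗ[k] J))
    (hH : ∀ m : M, m ≠ 0 → ∃ h ∈ H, h m ≠ 0) : H = ⊤ := by
  have := hJ.finite
  have hM : IsFiniteLength k M :=
    isFiniteLength_iff_isNoetherian_isArtinian.2 ⟨inferInstance, inferInstance⟩
  have hD : IsFiniteLength k (M →ₗ[k] J) :=
    Module.length_ne_top_iff.1 (ne_top_of_le_ne_top (Module.length_ne_top_iff.2 hM)
      (hJ.length_dual_le hM))
  obtain ⟨_, _⟩ := isFiniteLength_iff_isNoetherian_isArtinian.1 hD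
  have hHf : IsFiniteLength k H :=
    isFiniteLength_iff_isNoetherian_isArtinian.2 ⟨inferInstance, inferInstance⟩
  by_contra hne
  have h1 := Submodule.length_lt hne
  -- Separation of points makes `ev` injective, so `M` is no longer than the dual of `H`, hence no
  -- longer than `H`. A proper `H` would be strictly shorter than the dual of `M`, hence than `M`.
  let ev : M →ₗ[k] (H →ₗ[k] J) :=
    { toFun := fun m => (LinearMap.applyₗ m : (M →ₗ[k] J) →ₗ[k] J) ∘ₗ H.subtype
      map_add' := fun m m' => by ext h; simp
      map_smul' := fun r m => by ext h; simp }
  have hev : Function.Injective ev := by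
    rw [injective_iff_map_eq_zero]
    intro m hm
    by_contra hne
    obtain ⟨h, hh, hm'⟩ := hH m hne
    exact hm' (LinearMap.congr_fun hm (⟨h, hh⟩ : H))
  have h2 := (Module.length_le_of_injective ev hev).trans (hJ.length_dual_le hHf)
  exact absurd (h1.trans_le ((hJ.length_dual_le hM).trans h2)) (lt_irrefl _)

end IsMinimalInjectiveCogenerator

/-! ### Almost split extensions and representability of the dual -/

/-- Every endomorphism `f` of `X` is invertible, or `𝟙 X - f` is. -/
def HasLocalEnd {𝒟 : Type u} [Category.{v} 𝒟] [Preadditive 𝒟] (X : 𝒟) : Prop :=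
  ∀ f : X ⟶ X, IsIso f ∨ IsIso (𝟙 X - f)

/-- A biadditive bifunctor `Ext` to `k`-modules for which every extension `δ ∈ Ext B A` has an
inflation out of `A` and a deflation onto `B` that fit into exact sequences with `Ext`. -/
structure ExactExt (k : Type uk) [CommRing k] (𝒟 : Type u) [Category.{v} 𝒟] [Preadditive 𝒟] where
  Ext : 𝒟 → 𝒟 → ModuleCat.{w} k
  push {B A A' : 𝒟} (a : A ⟶ A') : Ext B A →ₗ[k] Ext B A'
  pull {B B' A : 𝒟} (b : B' ⟶ B) : Ext B A →ₗ[k] Ext B' A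
  push_id {B A : 𝒟} (θ : Ext B A) : push (𝟙 A) θ = θ
  pull_id {B A : 𝒟} (θ : Ext B A) : pull (𝟙 B) θ = θ
  push_comp {B A A' A'' : 𝒟} (f : A ⟶ A') (g : A' ⟶ A'') (θ : Ext B A) :
    push (f ≫ g) θ = push g (push f θ)
  pull_comp {B B' B'' A : 𝒟} (f : B'' ⟶ B') (g : B' ⟶ B) (θ : Ext B A) :
    pull (f ≫ g) θ = pull f (pull g θ)
  push_add {B A A' : 𝒟} (f g : A ⟶ A') (θ : Ext B A) : push (f + g) θ = push f θ + push g θ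
  pull_add {B B' A : 𝒟} (f g : B' ⟶ B) (θ : Ext B A) : pull (f + g) θ = pull f θ + pull g θ
  push_pull {B B' A A' : 𝒟} (a : A ⟶ A') (b : B' ⟶ B) (θ : Ext B A) :
    push a (pull b θ) = pull b (push a θ)
  -- Scalars need only act through endomorphisms. This suffices to make the orbits and sets of
  -- functionals below `k`-submodules, without a linear structure on `𝒟`.
  exists_push_eq_smul (r : k) (A : 𝒟) : ∃ e : A ⟶ A, ∀ (B : 𝒟) (θ : Ext B A), push e θ = r • θ
  exists_pull_eq_smul (r : k) (B : 𝒟) : ∃ e : B ⟶ B, ∀ (A : 𝒟) (θ : Ext B A), pull e θ = r • θ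
  exists_inflation {B A : 𝒟} (δ : Ext B A) : ∃ (M : 𝒟) (f : A ⟶ M), push f δ = 0 ∧
    (∀ (S : 𝒟) (g : A ⟶ S), push g δ = 0 → ∃ h : M ⟶ S, f ≫ h = g) ∧
    ∀ (S : 𝒟) (θ : Ext S A), push f θ = 0 → ∃ c : S ⟶ B, pull c δ = θ
  exists_deflation {B A : 𝒟} (δ : Ext B A) : ∃ (M : 𝒟) (f : M ⟶ B), pull f δ = 0 ∧
    (∀ (S : 𝒟) (g : S ⟶ B), pull g δ = 0 → ∃ h : S ⟶ M, h ≫ f = g) ∧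
    ∀ (S : 𝒟) (θ : Ext B S), pull f θ = 0 → ∃ c : A ⟶ S, push c δ = θ

namespace ExactExt

variable {k : Type uk} [CommRing k] {𝒟 : Type u} [Category.{v} 𝒟] [Preadditive 𝒟]

/-- The bifunctor on the opposite category with the two variables interchanged. -/
def op (E : ExactExt.{w} k 𝒟) : ExactExt.{w} k 𝒟ᵒᵖ where
  Ext B A := E.Ext A.unop B.unop
  push a := E.pull a.unop
  pull b := E.push b.unop
  push_id := E.pull_id
  pull_id := E.push_id
  push_comp f g := E.pull_comp g.unop f.unop
  pull_comp f g := E.push_comp g.unop f.unop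
  push_add f g := E.pull_add f.unop g.unop
  pull_add f g := E.push_add f.unop g.unop
  push_pull a b θ := (E.push_pull b.unop a.unop θ).symm
  exists_push_eq_smul r A := by
    obtain ⟨e, he⟩ := E.exists_pull_eq_smul r A.unop
    exact ⟨e.op, fun B θ => he B.unop θ⟩
  exists_pull_eq_smul r B := by
    obtain ⟨e, he⟩ := E.exists_push_eq_smul r B.unop
    exact ⟨e.op, fun A θ => he A.unop θ⟩
  exists_inflation δ := by
    obtain ⟨M, f, h1, h2, h3⟩ := E.exists_deflation δ
    refine ⟨Opposite.op M, f.op, h1, fun S g hg => ?_, fun S θ hθ => ?_⟩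
    · obtain ⟨h, hh⟩ := h2 _ g.unop hg
      exact ⟨h.op, Quiver.Hom.unop_inj hh⟩
    · obtain ⟨c, hc⟩ := h3 _ θ hθ
      exact ⟨c.op, hc⟩
  exists_deflation δ := by
    obtain ⟨M, f, h1, h2, h3⟩ := E.exists_inflation δ
    refine ⟨Opposite.op M, f.op, h1, fun S g hg => ?_, fun S θ hθ => ?_⟩
    · obtain ⟨h, hh⟩ := h2 _ g.unop hg
      exact ⟨h.op, Quiver.Hom.unop_inj hh⟩
    · obtain ⟨c, hc⟩ := h3 _ θ hθ
      exact ⟨c.op, hc⟩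

variable (E : ExactExt.{w} k 𝒟)

/-- `δ` is nonzero and is annihilated by all morphisms that are not split. -/
structure AlmostSplit {B A : 𝒟} (δ : E.Ext B A) : Prop where
  ne_zero : δ ≠ 0
  push_eq_zero : ∀ {S : 𝒟} (g : A ⟶ S), ¬ IsSplitMono g → E.push g δ = 0
  pull_eq_zero : ∀ {S : 𝒟} (g : S ⟶ B), ¬ IsSplitEpi g → E.pull g δ = 0

lemma almostSplit_op_iff {B A : 𝒟} (δ : E.Ext B A) :
    E.op.AlmostSplit (B := Opposite.op A) (A := Opposite.op B) δ ↔ E.AlmostSplit δ := by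
  constructor
  · rintro ⟨h1, h2, h3⟩
    refine ⟨h1, fun g hg => h3 g.op fun h => hg ?_, fun g hg => h2 g.op fun h => hg ?_⟩
    · obtain ⟨⟨s⟩⟩ := h
      exact ⟨⟨s.section_.unop, Quiver.Hom.op_inj s.id⟩⟩
    · obtain ⟨⟨s⟩⟩ := h
      exact ⟨⟨s.retraction.unop, Quiver.Hom.op_inj s.id⟩⟩
  · rintro ⟨h1, h2, h3⟩
    refine ⟨h1, fun g hg => h3 g.unop fun h => hg ?_, fun g hg => h2 g.unop fun h => hg ?_⟩
    · obtain ⟨⟨s⟩⟩ := h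
      exact ⟨⟨s.section_.op, Quiver.Hom.unop_inj s.id⟩⟩
    · obtain ⟨⟨s⟩⟩ := h
      exact ⟨⟨s.retraction.op, Quiver.Hom.unop_inj s.id⟩⟩

variable {J : Type uk} [AddCommGroup J] [Module k J]

/-- The functional `φ` on `Ext X A` represents the functor `Y ↦ Hom(Ext X Y, J)`: the pairing
`(f, μ) ↦ φ (f_* μ)` identifies `Hom(Ext X Y, J)` with the morphisms `Y ⟶ A` modulo those that act
by zero on extensions. -/
structure Represents {X A : 𝒟} (φ : E.Ext X A →ₗ[k] J) : Prop where
  exists_eq : ∀ {Y : 𝒟} (ψ : E.Ext X Y →ₗ[k] J), ∃ f : Y ⟶ A, ∀ μ, φ (E.push f μ) = ψ μ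
  push_eq_zero : ∀ {Y : 𝒟} (f : Y ⟶ A), (∀ μ, φ (E.push f μ) = 0) →
    ∀ (Z : 𝒟) (θ : E.Ext Z Y), E.push f θ = 0

section

variable {E}

/-- The inflation belonging to `η ≠ 0` is not a split mono, so it kills `δ`; by exactness, whatever
it kills is a pullback of `η`. -/
lemma AlmostSplit.exists_pull_eq {B A : 𝒟} {δ : E.Ext B A} (h : E.AlmostSplit δ) {Z : 𝒟}
    {η : E.Ext Z A} (hη : η ≠ 0) : ∃ g : B ⟶ Z, E.pull g η = δ := by
  obtain ⟨M, f, h1, -, h3⟩ := E.exists_inflation η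
  refine h3 _ _ (h.push_eq_zero f fun hf => hη ?_)
  rw [← E.push_id η, ← IsSplitMono.id f, E.push_comp, h1, map_zero]

lemma AlmostSplit.exists_push_eq {B A : 𝒟} {δ : E.Ext B A} (h : E.AlmostSplit δ) {Y : 𝒟}
    {μ : E.Ext B Y} (hμ : μ ≠ 0) : ∃ g : Y ⟶ A, E.push g μ = δ := by
  obtain ⟨M, f, h1, -, h3⟩ := E.exists_deflation μ
  refine h3 _ _ (h.pull_eq_zero f fun hf => hμ ?_)
  rw [← E.pull_id μ, ← IsSplitEpi.id f, E.pull_comp, h1, map_zero]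

/-- A functional that does not vanish on an almost split extension represents the dual of
`Ext X`. -/
lemma AlmostSplit.represents [IsArtinianRing k] (hJ : IsMinimalInjectiveCogenerator k J)
    (hfin : ∀ A B : 𝒟, Module.Finite k (E.Ext B A)) {X A : 𝒟} {δ : E.Ext X A}
    (h : E.AlmostSplit δ) {φ : E.Ext X A →ₗ[k] J} (hφ : φ δ ≠ 0) : E.Represents φ := by
  refine ⟨fun {Y} ψ => ?_, fun {Y} f hf Z θ => ?_⟩
  · have := hfin Y X
    let H : Submodule k (E.Ext X Y →ₗ[k] J) :=
      { carrier := Set.range fun f : Y ⟶ A => φ ∘ₗ E.push f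
        add_mem' := by
          rintro _ _ ⟨f, rfl⟩ ⟨g, rfl⟩
          exact ⟨f + g, by ext μ; simp [E.push_add]⟩
        zero_mem' := by
          obtain ⟨e, he⟩ := E.exists_push_eq_smul 0 A
          -- Any morphism followed by an endomorphism acting as the scalar `0` yields the zero
          -- functional.
          refine ⟨(0 : Y ⟶ A) ≫ e, ?_⟩
          ext μ
          simp only [LinearMap.comp_apply, E.push_comp, he, zero_smul, map_zero,
            LinearMap.zero_apply]
        smul_mem' := by
          rintro r _ ⟨f, rfl⟩
          obtain ⟨e, he⟩ := E.exists_push_eq_smul r A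
          exact ⟨f ≫ e, by ext μ; simp [E.push_comp, he]⟩ }
    have hH : H = ⊤ := hJ.eq_top_of_separates H fun μ hμ => by
      obtain ⟨f, hf⟩ := h.exists_push_eq hμ
      exact ⟨_, ⟨f, rfl⟩, by simpa [hf] using hφ⟩
    obtain ⟨f, hf⟩ : ψ ∈ H := hH ▸ Submodule.mem_top
    exact ⟨f, fun μ => LinearMap.congr_fun hf μ⟩
  -- If `f_* θ ≠ 0`, some pullback `g^* f_* θ = f_* g^* θ` equals `δ`, where `φ` is nonzero; yet `φ
  -- ∘ f_* = 0`.
  · by_contra hne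
    obtain ⟨g, hg⟩ := h.exists_pull_eq hne
    rw [← E.push_pull] at hg
    exact hφ (hg ▸ hf _)

/-- For `X` with local endomorphism ring, a nonzero artinian `Ext X A` contains a nonzero extension
annihilated by all endomorphisms of `X` that are not split epimorphisms. -/
lemma exists_pull_endo_eq_zero {X A : 𝒟} (hX : HasLocalEnd X) [IsArtinian k (E.Ext X A)]
    {δ₀ : E.Ext X A} (h₀ : δ₀ ≠ 0) :
    ∃ δ : E.Ext X A, δ ≠ 0 ∧ ∀ g : X ⟶ X, ¬ IsSplitEpi g → E.pull g δ = 0 := by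
  let orb (δ : E.Ext X A) : Submodule k (E.Ext X A) :=
    { carrier := Set.range fun h : X ⟶ X => E.pull h δ
      add_mem' := by
        rintro _ _ ⟨f, rfl⟩ ⟨g, rfl⟩
        exact ⟨f + g, E.pull_add f g δ⟩
      zero_mem' := by
        obtain ⟨e, he⟩ := E.exists_pull_eq_smul 0 X
        exact ⟨e, by simp [he]⟩
      smul_mem' := by
        rintro r _ ⟨f, rfl⟩
        obtain ⟨e, he⟩ := E.exists_pull_eq_smul r X
        exact ⟨e ≫ f, by simp [E.pull_comp, he]⟩ }
  have hself : ∀ δ, δ ∈ orb δ := fun δ => ⟨𝟙 X, E.pull_id δ⟩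
  -- Take `δ` with minimal orbit. If `g^* δ ≠ 0`, the two orbits agree and `δ = (h ≫ g)^* δ`.
  -- Locality leaves two cases: `h ≫ g` is invertible and `g` splits, or `𝟙 - h ≫ g` is invertible
  -- and kills `δ`.
  obtain ⟨N, ⟨δ, hδ, rfl⟩, hmin⟩ := IsArtinian.set_has_minimal (R := k)
    {N : Submodule k (E.Ext X A) | ∃ δ, δ ≠ 0 ∧ orb δ = N} ⟨_, δ₀, h₀, rfl⟩
  refine ⟨δ, hδ, fun g hg => ?_⟩
  by_contra hne
  have hle : orb (E.pull g δ) ≤ orb δ := by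
    rintro _ ⟨h, rfl⟩
    exact ⟨h ≫ g, E.pull_comp h g δ⟩
  have heq : orb (E.pull g δ) = orb δ :=
    hle.eq_of_not_lt (hmin _ ⟨_, hne, rfl⟩)
  obtain ⟨h, hh⟩ : δ ∈ orb (E.pull g δ) := heq ▸ hself δ
  simp only [← E.pull_comp] at hh
  rcases hX (h ≫ g) with hi | hi
  · exact hg ⟨⟨⟨inv (h ≫ g) ≫ h, by rw [Category.assoc, IsIso.inv_hom_id]⟩⟩⟩
  · apply hδ
    have h0 : E.pull (𝟙 X - h ≫ g) δ = 0 := by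
      have := E.pull_add (𝟙 X - h ≫ g) (h ≫ g) δ
      rw [sub_add_cancel, E.pull_id, hh] at this
      simpa using this
    rw [← E.pull_id δ, ← IsIso.inv_hom_id (𝟙 X - h ≫ g), E.pull_comp, h0, map_zero]

/-- If the dual of `Ext X` is representable, there is an almost split extension of `X`. -/
lemma Represents.exists_almostSplit [IsArtinianRing k] (hJ : IsInjectiveCogenerator k J)
    (hfin : ∀ A B : 𝒟, Module.Finite k (E.Ext B A))
    (hdec : ∀ {X A : 𝒟} (δ : E.Ext X A), δ ≠ 0 →
      ∃ (A' : 𝒟) (p : A ⟶ A'), HasLocalEnd A' ∧ E.push p δ ≠ 0)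
    {X A Y : 𝒟} (hX : HasLocalEnd X) {φ : E.Ext X A →ₗ[k] J} (h : E.Represents φ)
    {μ : E.Ext X Y} (hμ : μ ≠ 0) :
    ∃ (A' : 𝒟) (δ : E.Ext X A'), E.AlmostSplit δ := by
  have := hfin Y X
  have := hfin A X
  obtain ⟨ψ, hψ⟩ := hJ.exists_apply_ne_zero hμ
  obtain ⟨f, hf⟩ := h.exists_eq ψ
  obtain ⟨δ, hδ, hg⟩ := exists_pull_endo_eq_zero (δ₀ := E.push f μ) hX (by
    intro h0
    rw [← hf, h0, map_zero] at hψ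
    exact hψ rfl)
  -- an extension by `A` that restricts to zero along all morphisms from `X` is zero
  have key : ∀ {S : 𝒟} (θ : E.Ext S A), (∀ h : X ⟶ S, E.pull h θ = 0) → θ = 0 := by
    intro S θ hθ
    -- Exactness makes the inflation `f` of `θ` injective on `Ext X`, so `φ` extends along it to a
    -- functional of the form `φ ∘ u_*`. Then `f ≫ u - 𝟙` gives the zero functional, so it acts by
    -- zero and `θ = u_* f_* θ = 0`.
    obtain ⟨M, f, h1, -, h3⟩ := E.exists_inflation θ
    have := hfin M X
    have hinj : LinearMap.ker (E.push (B := X) f) = ⊥ := by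
      rw [LinearMap.ker_eq_bot']
      intro ε hε
      obtain ⟨c, rfl⟩ := h3 _ ε hε
      exact hθ c
    have hinj' := LinearMap.ker_eq_bot.1 hinj
    obtain ⟨ψ, hψ⟩ := hJ.exists_extension hinj' φ
    obtain ⟨u, hu⟩ := h.exists_eq ψ
    have hz := h.push_eq_zero (f ≫ u - 𝟙 A) (fun ε => by
      have h4 := E.push_add (f ≫ u - 𝟙 A) (𝟙 A) ε
      rw [sub_add_cancel, E.push_id] at h4
      rw [eq_sub_of_add_eq h4.symm, map_sub, E.push_comp, hu, hψ, sub_self]) S θ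
    have h4 := E.push_add (f ≫ u - 𝟙 A) (𝟙 A) θ
    rwa [sub_add_cancel, E.push_id, hz, zero_add, E.push_comp, h1, map_zero, eq_comm] at h4
  have hg' : ∀ {S : 𝒟} (g : S ⟶ X), ¬ IsSplitEpi g → E.pull g δ = 0 := by
    intro S g hns
    -- For `h : X ⟶ S`, the endomorphism `h ≫ g` is not a split epi, as otherwise `g` would be one.
    refine key _ fun h => ?_
    rw [← E.pull_comp]
    exact hg _ fun hs => hns
      ⟨⟨⟨section_ (h ≫ g) ≫ h, by rw [Category.assoc, IsSplitEpi.id]⟩⟩⟩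
  obtain ⟨A', p, hA', hp⟩ := hdec δ hδ
  have hg'' : ∀ {S : 𝒟} (g : S ⟶ X), ¬ IsSplitEpi g → E.pull g (E.push p δ) = 0 := by
    intro S g hns
    rw [← E.push_pull, hg' g hns, map_zero]
  refine ⟨A', E.push p δ, hp, fun {S} g hns => ?_, hg''⟩
  by_contra hne
  -- If `g_*` does not kill the extension, the deflation `l` of its image is not a split epi and
  -- kills the extension itself. Exactness then recovers the extension as its own image under `g ≫
  -- u`, and locality of `A'` applies.
  obtain ⟨M, l, h1, -, h3⟩ := E.exists_deflation (E.push g (E.push p δ))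
  obtain ⟨u, hu⟩ := h3 _ (E.push p δ) (hg'' l fun hl => hne (by
    rw [← E.pull_id (E.push g (E.push p δ)), ← IsSplitEpi.id l, E.pull_comp, h1, map_zero]))
  rw [← E.push_comp] at hu
  rcases hA' (g ≫ u) with hi | hi
  · exact hns ⟨⟨⟨u ≫ inv (g ≫ u), by rw [← Category.assoc, IsIso.hom_inv_id]⟩⟩⟩
  · apply hp
    have h0 : E.push (𝟙 A' - g ≫ u) (E.push p δ) = 0 := by
      have := E.push_add (𝟙 A' - g ≫ u) (g ≫ u) (E.push p δ)
      rw [sub_add_cancel, E.push_id, hu] at this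
      simpa using this
    rw [← E.push_id (E.push p δ), ← IsIso.hom_inv_id (𝟙 A' - g ≫ u), E.push_comp, h0, map_zero]

end

/-- For `X` with local endomorphism ring and `Ext X ≠ 0`, the dual of `Ext X` is representable if and
only if there is an almost split extension of `X`. -/
theorem exists_represents_iff_exists_almostSplit [IsArtinianRing k]
    (hJ : IsMinimalInjectiveCogenerator k J)
    (hfin : ∀ A B : 𝒟, Module.Finite k (E.Ext B A))
    (hdec : ∀ {X A : 𝒟} (δ : E.Ext X A), δ ≠ 0 →
      ∃ (A' : 𝒟) (p : A ⟶ A'), HasLocalEnd A' ∧ E.push p δ ≠ 0)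
    {X : 𝒟} (hX : HasLocalEnd X) (hne : ∃ (Y : 𝒟) (μ : E.Ext X Y), μ ≠ 0) :
    (∃ (A : 𝒟) (φ : E.Ext X A →ₗ[k] J), E.Represents φ) ↔
      ∃ (A : 𝒟) (δ : E.Ext X A), E.AlmostSplit δ := by
  constructor
  · rintro ⟨A, φ, h⟩
    obtain ⟨Y, μ, hμ⟩ := hne
    exact h.exists_almostSplit hJ.toIsInjectiveCogenerator hfin hdec hX hμ
  · rintro ⟨A, δ, h⟩
    have := hfin A X
    obtain ⟨φ, hφ⟩ := hJ.exists_apply_ne_zero h.ne_zero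
    exact ⟨A, φ, h.represents hJ hfin hφ⟩

end ExactExt

/-! ### Local endomorphism rings and direct sum decompositions -/

section LocalEnd

variable {𝒞 : Type u} [Category.{v} 𝒞] [Preadditive 𝒞]

lemma hasLocalEnd_of_isLocalRing {X : 𝒞} (h : IsLocalRing (End X)) : HasLocalEnd X := by
  intro f
  have h1 : (show End X from f) + (show End X from 𝟙 X - f) = 1 := add_sub_cancel f (𝟙 X)
  rcases IsLocalRing.isUnit_or_isUnit_of_add_one h1 with h | h
  · exact Or.inl ((isUnit_iff_isIso _).1 h)
  · exact Or.inr ((isUnit_iff_isIso _).1 h)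

lemma id_ne_zero_of_isLocalRing {X : 𝒞} (h : IsLocalRing (End X)) : 𝟙 X ≠ 0 :=
  (one_ne_zero : (1 : End X) ≠ 0)

lemma HasLocalEnd.of_iso {X Y : 𝒞} (h : HasLocalEnd X) (e : X ≅ Y) : HasLocalEnd Y := by
  intro f
  rcases h (e.hom ≫ f ≫ e.inv) with h | h
  · left
    have : f = e.inv ≫ (e.hom ≫ f ≫ e.inv) ≫ e.hom := by simp
    rw [this]; infer_instance
  · right
    have : 𝟙 Y - f = e.inv ≫ (𝟙 X - e.hom ≫ f ≫ e.inv) ≫ e.hom := by simp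
    rw [this]; infer_instance

lemma HasLocalEnd.op {X : 𝒞} (h : HasLocalEnd X) : HasLocalEnd (op X) := by
  intro f
  rcases h f.unop with h | h
  · exact Or.inl ((isIso_unop_iff f).1 h)
  · exact Or.inr ((isIso_unop_iff (𝟙 (Opposite.op X) - f)).1 h)

lemma HasLocalEnd.isIso_or_of_add {X : 𝒞} (h : HasLocalEnd X) {f g : X ⟶ X}
    (hfg : IsIso (f + g)) : IsIso f ∨ IsIso g := by
  rcases h (f ≫ inv (f + g)) with h | h
  · left
    have : f = (f ≫ inv (f + g)) ≫ (f + g) := by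
      rw [Category.assoc, IsIso.inv_hom_id, Category.comp_id]
    rw [this]; infer_instance
  · right
    have h1 : 𝟙 X - f ≫ inv (f + g) = g ≫ inv (f + g) := by
      rw [sub_eq_iff_eq_add, add_comm, ← Preadditive.add_comp, IsIso.hom_inv_id]
    rw [h1] at h
    have : g = (g ≫ inv (f + g)) ≫ (f + g) := by
      rw [Category.assoc, IsIso.inv_hom_id, Category.comp_id]
    rw [this]; infer_instance

/-- `HasLocalEnd` also holds for zero objects; `𝟙 X ≠ 0` excludes them, since there the empty sum is
an isomorphism. -/
lemma HasLocalEnd.exists_isIso_of_sum {X : 𝒞} (h : HasLocalEnd X) (hX : 𝟙 X ≠ 0) {ι : Type*}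
    (s : Finset ι) (f : ι → (X ⟶ X)) (hf : IsIso (∑ i ∈ s, f i)) : ∃ i ∈ s, IsIso (f i) := by
  classical
  induction s using Finset.induction_on with
  | empty =>
    rw [Finset.sum_empty] at hf
    exact absurd (by rw [← IsIso.hom_inv_id (0 : X ⟶ X), zero_comp]) hX
  | insert a s ha ih =>
    rw [Finset.sum_insert ha] at hf
    rcases h.isIso_or_of_add hf with h | h
    · exact ⟨a, Finset.mem_insert_self a s, h⟩
    · obtain ⟨i, hi, hi'⟩ := ih h
      exact ⟨i, Finset.mem_insert_of_mem hi, hi'⟩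

/-- The map `c` has a retraction `d'`. Locality of `Y` makes `d' ≫ c` invertible, so that `c` is
also a split epi, or else `𝟙 - d' ≫ c` is invertible; the latter annihilates `d'`, forcing `𝟙 Z =
0`. -/
lemma HasLocalEnd.isIso_of_isIso_comp {Y Z : 𝒞} (h : HasLocalEnd Y) (hZ : 𝟙 Z ≠ 0) (c : Z ⟶ Y)
    (d : Y ⟶ Z) (hcd : IsIso (c ≫ d)) : IsIso c := by
  have h1 : c ≫ d ≫ inv (c ≫ d) = 𝟙 Z := by rw [← Category.assoc, IsIso.hom_inv_id]
  generalize d ≫ inv (c ≫ d) = d' at h1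
  rcases h (d' ≫ c) with hi | hi
  · have : IsSplitEpi c := ⟨⟨⟨inv (d' ≫ c) ≫ d', by rw [Category.assoc, IsIso.inv_hom_id]⟩⟩⟩
    have : IsSplitMono c := ⟨⟨⟨d', h1⟩⟩⟩
    exact isIso_of_mono_of_isSplitEpi c
  · have h2 : (𝟙 Y - d' ≫ c) ≫ d' = 0 := by
      rw [Preadditive.sub_comp, Category.assoc, h1]; simp
    have h3 : d' = 0 := by
      rw [← cancel_epi (𝟙 Y - d' ≫ c), h2, comp_zero]
    rw [h3, comp_zero] at h1
    exact absurd h1.symm hZ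

end LocalEnd

section LocalDecomp

variable {𝒞 : Type u} [Category.{v} 𝒞] [Preadditive 𝒞]

/-- `X` is a direct sum of `m` objects with local endomorphism rings. -/
structure LocalDecomp (m : ℕ) (X : 𝒞) where
  Y : Fin m → 𝒞
  ι : ∀ i, Y i ⟶ X
  π : ∀ i, X ⟶ Y i
  hasLocalEnd : ∀ i, HasLocalEnd (Y i)
  id_ne_zero : ∀ i, 𝟙 (Y i) ≠ 0
  ι_π_self : ∀ i, ι i ≫ π i = 𝟙 (Y i)
  ι_π_ne : ∀ i j, i ≠ j → ι i ≫ π j = 0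
  total : ∑ i, π i ≫ ι i = 𝟙 X

lemma IsKrullSchmidt.exists_localDecomp (h : IsKrullSchmidt 𝒞) (X : 𝒞) :
    ∃ m, Nonempty (LocalDecomp m X) := by
  obtain ⟨m, Y, b, hY, ⟨hb⟩, ⟨e⟩⟩ := h X
  refine ⟨m, ⟨⟨Y, fun i => b.ι i ≫ e.inv, fun i => e.hom ≫ b.π i,
    fun i => hasLocalEnd_of_isLocalRing (hY i), fun i => id_ne_zero_of_isLocalRing (hY i),
    fun i => by simp, fun i j hij => by simp [bicone_ι_π_ne b hij], ?_⟩⟩⟩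
  have h2 : ∑ i, b.π i ≫ b.ι i = 𝟙 b.pt := IsBilimit.total hb
  calc ∑ i, (e.hom ≫ b.π i) ≫ b.ι i ≫ e.inv = e.hom ≫ (∑ i, b.π i ≫ b.ι i) ≫ e.inv := by
        rw [Preadditive.sum_comp, Preadditive.comp_sum]
        simp
    _ = 𝟙 X := by rw [h2]; simp

variable [HasZeroObject 𝒞] [HasBinaryBiproducts 𝒞]

namespace LocalDecomp

/-- One summand can be removed. -/
lemma exists_compl {m : ℕ} {X : 𝒞} (D : LocalDecomp (m + 1) X) (j : Fin (m + 1)) :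
    ∃ (X' : 𝒞) (u : X' ⟶ X) (p : X ⟶ X'), Nonempty (LocalDecomp m X') ∧ u ≫ p = 𝟙 X' ∧
      p ≫ u = 𝟙 X - D.π j ≫ D.ι j ∧ u ≫ D.π j = 0 ∧ D.ι j ≫ p = 0 := by
  have : HasFiniteProducts 𝒞 := hasFiniteProducts_of_has_binary_and_terminal
  have : HasFiniteBiproducts 𝒞 := HasFiniteBiproducts.of_hasFiniteProducts
  let Y' : Fin m → 𝒞 := fun i => D.Y (j.succAbove i)
  refine ⟨⨁ Y', biproduct.desc fun i => D.ι (j.succAbove i),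
    biproduct.lift fun i => D.π (j.succAbove i), ⟨⟨Y', biproduct.ι Y', biproduct.π Y',
      fun i => D.hasLocalEnd _, fun i => D.id_ne_zero _, fun i => by simp,
      fun i j hij => biproduct.ι_π_ne Y' hij, biproduct.total⟩⟩, ?_, ?_, ?_, ?_⟩
  · ext a b
    by_cases hab : a = b
    · subst hab
      simp [D.ι_π_self, Y']
    · simp [biproduct.ι_π_ne Y' (Ne.symm hab),
        D.ι_π_ne _ _ (fun h => hab (Fin.succAbove_right_injective h).symm)]
  · rw [biproduct.lift_desc, ← D.total, Fin.sum_univ_succAbove _ j, add_sub_cancel_left]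
  · ext a
    simp [D.ι_π_ne _ _ (Fin.succAbove_ne j a)]
  · ext a
    simp [D.ι_π_ne _ _ (Fin.succAbove_ne j a).symm]

/-- A direct summand with local endomorphism ring has a complement with one summand less. -/
lemma exists_splitting {m : ℕ} {X Z : 𝒞} (D : LocalDecomp m X) (hZ : HasLocalEnd Z)
    (hZ0 : 𝟙 Z ≠ 0) (a : Z ⟶ X) (q : X ⟶ Z) (haq : a ≫ q = 𝟙 Z) :
    ∃ (m' : ℕ) (X' : 𝒞) (r : X ⟶ X') (s : X' ⟶ X), m' < m ∧ Nonempty (LocalDecomp m' X') ∧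
      s ≫ r = 𝟙 X' ∧ r ≫ s = 𝟙 X - q ≫ a := by
  have hsum : ∑ i, (a ≫ D.π i) ≫ D.ι i ≫ q = 𝟙 Z := by
    have : ∑ i, (a ≫ D.π i) ≫ D.ι i ≫ q = a ≫ (∑ i, D.π i ≫ D.ι i) ≫ q := by
      rw [Preadditive.sum_comp, Preadditive.comp_sum]
      simp
    rw [this, D.total, Category.id_comp, haq]
  -- Exchange argument: `𝟙 Z` is a sum over the summands of `X`, so one term is invertible and `a ≫
  -- D.π j` identifies `Z` with `D.Y j`.
  obtain ⟨j, -, hj⟩ := hZ.exists_isIso_of_sum hZ0 Finset.univ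
    (fun i => (a ≫ D.π i) ≫ D.ι i ≫ q) (by rw [hsum]; infer_instance)
  have hc := (D.hasLocalEnd j).isIso_of_isIso_comp hZ0 (a ≫ D.π j) _ hj
  obtain ⟨m, rfl⟩ : ∃ m', m = m' + 1 := ⟨m - 1, by have := j.2; omega⟩
  obtain ⟨X', u, p, hX', hup, hpu, huπ, hιp⟩ := D.exists_compl j
  have ht : a ≫ D.π j ≫ inv (a ≫ D.π j) = 𝟙 Z := by rw [← Category.assoc, IsIso.hom_inv_id]
  have ht' : inv (a ≫ D.π j) ≫ a ≫ D.π j = 𝟙 _ := IsIso.inv_hom_id _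
  generalize inv (a ≫ D.π j) = t at ht ht'
  have har : a ≫ (p - D.π j ≫ t ≫ a ≫ p) = 0 := by
    rw [Preadditive.comp_sub]
    have : a ≫ D.π j ≫ t ≫ a ≫ p = (a ≫ D.π j ≫ t) ≫ a ≫ p := by simp only [Category.assoc]
    rw [this, ht, Category.id_comp, sub_self]
  -- The complement of `D.Y j` also complements the image of `a`. The projection is corrected to
  -- vanish on `a`, the inclusion to land in the kernel of `q`.
  refine ⟨m, X', p - D.π j ≫ t ≫ a ≫ p, u ≫ (𝟙 X - q ≫ a), Nat.lt_succ_self m, hX', ?_, ?_⟩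
  · rw [Category.assoc, Preadditive.sub_comp, Category.assoc, har, comp_zero, sub_zero,
      Category.id_comp, Preadditive.comp_sub, hup, ← Category.assoc, huπ, zero_comp, sub_zero]
  · have h1 : (p - D.π j ≫ t ≫ a ≫ p) ≫ u = 𝟙 X - D.π j ≫ t ≫ a := by
      simp only [Preadditive.sub_comp, Category.assoc, hpu, Preadditive.comp_sub,
        Category.comp_id]
      have : D.π j ≫ t ≫ a ≫ D.π j ≫ D.ι j = D.π j ≫ (t ≫ a ≫ D.π j) ≫ D.ι j := by
        simp only [Category.assoc]
      rw [this, ht', Category.id_comp]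
      abel
    rw [← Category.assoc, h1]
    have : a ≫ q ≫ a = a := by rw [← Category.assoc, haq, Category.id_comp]
    simp only [Preadditive.sub_comp, Preadditive.comp_sub, Category.comp_id, Category.id_comp,
      Category.assoc, this]
    abel

end LocalDecomp

lemma hasLocalEnd_of_indecomposable (hKS : IsKrullSchmidt 𝒞) {X : 𝒞} (hX : Indecomposable X) :
    HasLocalEnd X := by
  obtain ⟨m, ⟨D⟩⟩ := hKS.exists_localDecomp X
  cases m with
  | zero =>
    refine absurd ?_ hX.1
    rw [IsZero.iff_id_eq_zero, ← D.total]
    simp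
  | succ m =>
    obtain ⟨X', u, p, -, hup, hpu, huπ, hιp⟩ := D.exists_compl 0
    have e : X ≅ D.Y 0 ⊞ X' :=
      { hom := biprod.lift (D.π 0) p
        inv := biprod.desc (D.ι 0) u
        hom_inv_id := by rw [biprod.lift_desc, hpu]; abel
        inv_hom_id := by ext <;> simp [D.ι_π_self, hup, huπ, hιp] }
    rcases hX.2 _ _ e with h | h
    · exact absurd ((IsZero.iff_id_eq_zero _).1 h) (D.id_ne_zero 0)
    · refine (D.hasLocalEnd 0).of_iso ⟨D.ι 0, D.π 0, D.ι_π_self 0, ?_⟩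
      rw [h.eq_of_tgt p 0, zero_comp, eq_comm, sub_eq_zero] at hpu
      exact hpu.symm

end LocalDecomp

/-! ### The radical -/

section Radical

variable {𝒞 : Type u} [Category.{v} 𝒞] [Preadditive 𝒞]

lemma isIso_id_sub_comp_swap {A B : 𝒞} (f : A ⟶ B) (g : B ⟶ A) (h : IsIso (𝟙 A - f ≫ g)) :
    IsIso (𝟙 B - g ≫ f) := by
  have h1 : (𝟙 A - f ≫ g) ≫ inv (𝟙 A - f ≫ g) = 𝟙 A := IsIso.hom_inv_id _
  have h2 : inv (𝟙 A - f ≫ g) ≫ (𝟙 A - f ≫ g) = 𝟙 A := IsIso.inv_hom_id _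
  generalize inv (𝟙 A - f ≫ g) = t at h1 h2
  simp only [Preadditive.sub_comp, Preadditive.comp_sub, Category.id_comp, Category.comp_id,
    Category.assoc] at h1 h2
  have h1' : f ≫ g ≫ t = t - 𝟙 A := by rw [← h1]; abel
  have h2' : t ≫ f ≫ g = t - 𝟙 A := by rw [← h2]; abel
  -- The usual formula `(1 - gf)⁻¹ = 1 + g (1 - fg)⁻¹ f`.
  refine ⟨𝟙 B + g ≫ t ≫ f, ?_, ?_⟩
  · have : g ≫ f ≫ g ≫ t ≫ f = g ≫ (f ≫ g ≫ t) ≫ f := by simp only [Category.assoc]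
    simp only [Preadditive.sub_comp, Preadditive.comp_add, Category.id_comp, Category.comp_id,
      Category.assoc, this, h1', Preadditive.comp_sub]
    abel
  · have : g ≫ t ≫ f ≫ g ≫ f = g ≫ (t ≫ f ≫ g) ≫ f := by simp only [Category.assoc]
    simp only [Preadditive.add_comp, Preadditive.comp_sub, Category.id_comp, Category.comp_id,
      Category.assoc, this, h2', Preadditive.sub_comp]
    abel

lemma InRadical.comp {A B B' : 𝒞} {f : A ⟶ B} (h : InRadical f) (p : B' ⟶ A) :
    InRadical (p ≫ f) := by
  intro g
  rw [Category.assoc]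
  exact isIso_id_sub_comp_swap (f ≫ g) p (by rw [Category.assoc]; exact h (g ≫ p))

lemma InRadical.zero (A B : 𝒞) : InRadical (0 : A ⟶ B) := by
  intro g
  rw [zero_comp, sub_zero]
  infer_instance

lemma InRadical.add {A B : 𝒞} {f f' : A ⟶ B} (h : InRadical f) (h' : InRadical f') :
    InRadical (f + f') := by
  intro g
  have := h g
  have h2 : 𝟙 A - (f + f') ≫ g = (𝟙 A - f ≫ g) ≫ (𝟙 A - (inv (𝟙 A - f ≫ g) ≫ f') ≫ g) := by
    rw [Preadditive.comp_sub, Category.comp_id, Category.assoc, IsIso.hom_inv_id_assoc,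
      Preadditive.add_comp]
    abel
  have := h'.comp (inv (𝟙 A - f ≫ g)) g
  rw [h2]
  infer_instance

/-- If no identity of a nonzero local object factors through `f`, locality puts the restriction of
`f` to each summand in the radical, and `f` is a sum of composites of projections with these
restrictions. -/
lemma LocalDecomp.exists_of_not_inRadical {m : ℕ} {A B : 𝒞} (D : LocalDecomp m A) {f : A ⟶ B}
    (hf : ¬ InRadical f) : ∃ (Z : 𝒞) (a : Z ⟶ A) (b : B ⟶ Z), HasLocalEnd Z ∧ 𝟙 Z ≠ 0 ∧
      a ≫ f ≫ b = 𝟙 Z := by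
  by_contra! hc
  apply hf
  have h1 : ∀ i, InRadical (D.ι i ≫ f) := by
    intro i g
    rcases D.hasLocalEnd i ((D.ι i ≫ f) ≫ g) with h | h
    · exact absurd (by rw [← IsIso.hom_inv_id ((D.ι i ≫ f) ≫ g)]; simp only [Category.assoc])
        (hc (D.Y i) (D.ι i) (g ≫ inv ((D.ι i ≫ f) ≫ g)) (D.hasLocalEnd i) (D.id_ne_zero i))
    · exact h
  have h2 : f = ∑ i, D.π i ≫ D.ι i ≫ f := by
    conv_lhs => rw [← Category.id_comp f, ← D.total, Preadditive.sum_comp]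
    simp
  rw [h2]
  exact Finset.sum_induction _ InRadical (fun _ _ => InRadical.add) (InRadical.zero A B)
    fun i _ => (h1 i).comp (D.π i)

end Radical

/-! ### Removing contractible summands from complexes -/

/-- The least number of summands in a decomposition of `X` into objects with local endomorphism
rings. -/
noncomputable def localLength {𝒞 : Type u} [Category.{v} 𝒞] [Preadditive 𝒞] (X : 𝒞) : ℕ :=
  sInf {m | Nonempty (LocalDecomp m X)}

namespace NComplex

variable {𝒞 : Type u} [Category.{v} 𝒞] [Preadditive 𝒞] {n : ℕ} {A B : 𝒞}

lemma HtpyEquiv.refl (X : NComplex 𝒞 n A B) : X.HtpyEquiv X :=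
  ⟨𝟙 _, 𝟙 _, ⟨by simp, by simp⟩, ⟨by simp, by simp⟩, ⟨Homotopy.ofEq (by simp)⟩,
    ⟨Homotopy.ofEq (by simp)⟩⟩

lemma HasEnds.comp {X Y Z : NComplex 𝒞 n A B} {f : X.K ⟶ Y.K} {g : Y.K ⟶ Z.K}
    (hf : HasEnds (X := X) (Y := Y) f (𝟙 A) (𝟙 B)) (hg : HasEnds (X := Y) (Y := Z) g (𝟙 A) (𝟙 B)) :
    HasEnds (X := X) (Y := Z) (f ≫ g) (𝟙 A) (𝟙 B) := by
  obtain ⟨h1, h2⟩ := hf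
  obtain ⟨h3, h4⟩ := hg
  constructor
  · rw [HomologicalComplex.comp_f, Category.assoc, h3, ← Category.assoc, h1]; simp
  · rw [HomologicalComplex.comp_f, Category.assoc, h4, ← Category.assoc, h2]; simp

lemma HtpyEquiv.trans {X Y Z : NComplex 𝒞 n A B} (h : X.HtpyEquiv Y) (h' : Y.HtpyEquiv Z) :
    X.HtpyEquiv Z := by
  obtain ⟨f, g, hf, hg, ⟨H1⟩, ⟨H2⟩⟩ := h
  obtain ⟨f', g', hf', hg', ⟨H1'⟩, ⟨H2'⟩⟩ := h'
  refine ⟨f ≫ f', g' ≫ g, hf.comp hf', hg'.comp hg, ⟨?_⟩, ⟨?_⟩⟩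
  · exact (Homotopy.ofEq (by simp)).trans
      ((((H1'.compRight g).compLeft f).trans (Homotopy.ofEq (by simp))).trans H1)
  · exact (Homotopy.ofEq (by simp)).trans
      ((((H2.compRight f').compLeft g').trans (Homotopy.ofEq (by simp))).trans H2')

/-- Splitting the idempotents of an idempotent chain map that is homotopic to the identity and is
the identity on both ends. -/
lemma exists_htpyEquiv_of_retract (X : NComplex 𝒞 n A B) (e : X.K ⟶ X.K)
    (he : Homotopy (𝟙 X.K) e) (he0 : e.f 0 = 𝟙 _) (he1 : e.f ((n : ℤ) + 1) = 𝟙 _)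
    (X' : ℤ → 𝒞) (r : ∀ j, X.K.X j ⟶ X' j) (s : ∀ j, X' j ⟶ X.K.X j)
    (hsr : ∀ j, s j ≫ r j = 𝟙 _) (hrs : ∀ j, r j ≫ s j = e.f j) :
    ∃ Y : NComplex 𝒞 n A B, X.HtpyEquiv Y ∧ Y.K.X = X' := by
  have hz : ∀ j, IsZero (X.K.X j) → IsZero (X' j) := fun j hj => by
    rw [IsZero.iff_id_eq_zero, ← hsr, hj.eq_of_src (r j) 0, comp_zero]
  let K' : CochainComplex 𝒞 ℤ :=
    { X := X'
      d := fun p q => s p ≫ X.K.d p q ≫ r q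
      shape := fun p q hpq => by rw [X.K.shape _ _ hpq, zero_comp, comp_zero]
      d_comp_d' := fun p q t _ _ => by
        have h1 : X.K.d p q ≫ r q ≫ s q ≫ X.K.d q t = 0 := by
          rw [← Category.assoc (r q), hrs, e.comm, ← Category.assoc, X.K.d_comp_d, zero_comp]
        calc (s p ≫ X.K.d p q ≫ r q) ≫ s q ≫ X.K.d q t ≫ r t
            = s p ≫ (X.K.d p q ≫ r q ≫ s q ≫ X.K.d q t) ≫ r t := by simp only [Category.assoc]
          _ = 0 := by rw [h1, zero_comp, comp_zero] }
  let Y : NComplex 𝒞 n A B :=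
    { K := K'
      isZero_of_neg := fun i hi => hz i (X.isZero_of_neg i hi)
      isZero_of_gt := fun i hi => hz i (X.isZero_of_gt i hi)
      left := ⟨s 0, r 0, hsr 0, by rw [hrs, he0]⟩ ≪≫ X.left
      right := ⟨s _, r _, hsr _, by rw [hrs, he1]⟩ ≪≫ X.right }
  let R : X.K ⟶ Y.K :=
    { f := r
      comm' := fun p q _ => by
        change r p ≫ s p ≫ X.K.d p q ≫ r q = X.K.d p q ≫ r q
        rw [← Category.assoc, hrs, ← Category.assoc, e.comm, Category.assoc, ← hrs, Category.assoc,
          hsr, Category.comp_id] }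
  let S : Y.K ⟶ X.K :=
    { f := s
      comm' := fun p q _ => by
        change s p ≫ X.K.d p q = (s p ≫ X.K.d p q ≫ r q) ≫ s q
        simp only [Category.assoc, hrs]
        rw [← e.comm, ← hrs, ← Category.assoc, ← Category.assoc, hsr, Category.id_comp] }
  refine ⟨Y, ⟨R, S, ⟨?_, ?_⟩, ⟨?_, ?_⟩, ⟨?_⟩, ⟨Homotopy.ofEq ?_⟩⟩, rfl⟩
  · change r 0 ≫ s 0 ≫ X.left.hom = _
    rw [← Category.assoc, hrs, he0, Category.id_comp, Category.comp_id]
  · change r _ ≫ s _ ≫ X.right.hom = _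
    rw [← Category.assoc, hrs, he1, Category.id_comp, Category.comp_id]
  · change s 0 ≫ X.left.hom = (s 0 ≫ X.left.hom) ≫ _
    rw [Category.comp_id]
  · change s _ ≫ X.right.hom = (s _ ≫ X.right.hom) ≫ _
    rw [Category.comp_id]
  · exact (Homotopy.ofEq (by ext j; exact hrs j)).trans he.symm
  · ext j; exact hsr j

variable [HasZeroObject 𝒞] [HasBinaryBiproducts 𝒞]

/-- If a differential between middle terms is not in the radical, then a contractible summand can be
removed. -/
lemma exists_htpyEquiv_of_not_inRadical (hKS : IsKrullSchmidt 𝒞) (X : NComplex 𝒞 n A B) {i : ℤ}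
    (hi : 1 ≤ i) (hin : i + 1 ≤ n) (hrad : ¬ InRadical (X.K.d i (i + 1))) :
    ∃ Y : NComplex 𝒞 n A B, X.HtpyEquiv Y ∧
      (∀ j, localLength (Y.K.X j) ≤ localLength (X.K.X j)) ∧
      localLength (Y.K.X i) < localLength (X.K.X i) := by
  obtain ⟨m, ⟨D⟩⟩ := hKS.exists_localDecomp (X.K.X i)
  obtain ⟨Z, a, b, hZ, hZ0, hab⟩ := D.exists_of_not_inRadical hrad
  have split : ∀ {j : ℤ} (a' : Z ⟶ X.K.X j) (q : X.K.X j ⟶ Z), a' ≫ q = 𝟙 Z →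
      ∃ (X' : 𝒞) (r : X.K.X j ⟶ X') (s : X' ⟶ X.K.X j), s ≫ r = 𝟙 X' ∧
        r ≫ s = 𝟙 _ - q ≫ a' ∧ localLength X' < localLength (X.K.X j) := by
    intro j a' q h
    -- Krull–Schmidt makes the set of lengths nonempty, so the infimum is attained and is not the
    -- default value `0` of an empty infimum.
    obtain ⟨D⟩ : Nonempty (LocalDecomp (localLength (X.K.X j)) (X.K.X j)) :=
      Nat.sInf_mem (hKS.exists_localDecomp (X.K.X j))
    obtain ⟨m', X', r, s, hm, hX', h1, h2⟩ := D.exists_splitting hZ hZ0 a' q h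
    exact ⟨X', r, s, h1, h2, (Nat.sInf_le (s := {m | Nonempty (LocalDecomp m X')}) hX').trans_lt hm⟩
  -- The only nonzero component is `b ≫ a` from degree `i + 1` to `i`. Subtracting its
  -- null-homotopic map from the identity projects away the copies of `Z` in these two degrees. As
  -- `1 ≤ i` and `i + 1 ≤ n`, both end terms are untouched.
  let h : ∀ p q : ℤ, X.K.X p ⟶ X.K.X q := fun p q =>
    if hp : p = i + 1 then if hq : q = i then
      (X.K.XIsoOfEq hp).hom ≫ b ≫ a ≫ (X.K.XIsoOfEq hq).inv else 0 else 0
  have hh : h (i + 1) i = b ≫ a := by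
    simp [h]
  have hh' : ∀ p q, p ≠ i + 1 → h p q = 0 := fun p q hp => by simp only [h, dif_neg hp]
  let N : X.K ⟶ X.K := Homotopy.nullHomotopicMap h
  let e : X.K ⟶ X.K := 𝟙 X.K - N
  have hN : ∀ p, N.f p = X.K.d p (p + 1) ≫ h (p + 1) p + h p (p - 1) ≫ X.K.d (p - 1) p :=
    fun p => Homotopy.nullHomotopicMap_f (by simp) (by simp) h
  have he : ∀ p, e.f p = 𝟙 _ - N.f p := fun p => rfl
  have H : Homotopy (𝟙 X.K) e := (Homotopy.equivSubZero).symm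
    ((Homotopy.ofEq (sub_sub_cancel _ _)).trans (Homotopy.nullHomotopy h (fun p q hpq => by
      simp only [h]
      split_ifs with h1 h2
      · exact absurd (by subst h1 h2; simp) hpq
      · rfl
      · rfl)))
  have hei : e.f i = 𝟙 _ - (X.K.d i (i + 1) ≫ b) ≫ a := by
    rw [he, hN, hh, hh' i _ (by omega), zero_comp, add_zero, Category.assoc]
  have hei' : e.f (i + 1) = 𝟙 _ - b ≫ a ≫ X.K.d i (i + 1) := by
    rw [he, hN, hh' (i + 1 + 1) _ (by omega), comp_zero, zero_add]
    congr 1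
    have : i + 1 - 1 = i := by omega
    rw [this, hh, Category.assoc]
  have hej : ∀ j, j ≠ i → j ≠ i + 1 → e.f j = 𝟙 _ := by
    intro j h1 h2
    rw [he, hN, hh' (j + 1) _ (by omega), hh' j _ h2, comp_zero, zero_comp, add_zero, sub_zero]
  have hex : ∀ j, ∃ (X' : 𝒞) (r : X.K.X j ⟶ X') (s : X' ⟶ X.K.X j), s ≫ r = 𝟙 X' ∧
      r ≫ s = e.f j ∧ localLength X' ≤ localLength (X.K.X j) ∧
      (j = i → localLength X' < localLength (X.K.X j)) := by
    intro j
    by_cases h1 : j = i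
    · subst h1
      obtain ⟨X', r, s, h1, h2, h3⟩ := split a (X.K.d j (j + 1) ≫ b) hab
      exact ⟨X', r, s, h1, by rw [h2, hei], h3.le, fun _ => h3⟩
    · by_cases h2 : j = i + 1
      · subst h2
        obtain ⟨X', r, s, h1, h2, h3⟩ := split (a ≫ X.K.d i (i + 1)) b
          (by rw [Category.assoc, hab])
        exact ⟨X', r, s, h1, by rw [h2, hei'], h3.le, fun _ => h3⟩
      · exact ⟨X.K.X j, 𝟙 _, 𝟙 _, by simp, by rw [hej j h1 h2, Category.comp_id], le_rfl,
          fun h => absurd h h1⟩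
  choose X' r s hsr hrs hle hlt using hex
  obtain ⟨Y, hY, rfl⟩ := X.exists_htpyEquiv_of_retract e H (hej 0 (by omega) (by omega))
    (hej _ (by omega) (by omega)) X' r s hsr hrs
  exact ⟨Y, hY, hle, hlt i rfl⟩

end NComplex

/-! ### Exact sequences and minimal realizations in `n`-exangulated categories -/

namespace NExangulated

variable {k : Type uk} [CommRing k] {𝒞 : Type u} [Category.{v} 𝒞] [Preadditive 𝒞]
  [HasBinaryBiproducts 𝒞] [Linear k 𝒞] {n : ℕ} (T : NExangulated.{w} k 𝒞 n)

lemma push_pull {B B' A A' : 𝒞} (a : A ⟶ A') (b : B' ⟶ B) (x : T.E.Ext B A) :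
    T.E.push a (T.E.pull b x) = T.E.pull b (T.E.push a x) :=
  (LinearMap.congr_fun (congrArg ModuleCat.Hom.hom ((T.E.map b.op).naturality a)) x).symm

lemma push_zero {B A A' : 𝒞} : T.E.push (B := B) (0 : A ⟶ A') = 0 := by
  simpa using T.push_sub (0 : A ⟶ A') 0

lemma pull_zero {B B' A : 𝒞} : T.E.pull (A := A) (0 : B' ⟶ B) = 0 := by
  simpa using T.pull_sub (0 : B' ⟶ B) 0

lemma exists_mem_s {A B : 𝒞} (δ : T.E.Ext B A) : ∃ X : NComplex 𝒞 n A B, X ∈ T.s δ := by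
  obtain ⟨X, hX⟩ := T.s_class δ
  exact ⟨X, (hX X).2 (NComplex.HtpyEquiv.refl X)⟩

lemma mem_s_of_htpyEquiv {A B : 𝒞} {δ : T.E.Ext B A} {X Y : NComplex 𝒞 n A B} (hX : X ∈ T.s δ)
    (h : X.HtpyEquiv Y) : Y ∈ T.s δ := by
  obtain ⟨X₀, hX₀⟩ := T.s_class δ
  exact (hX₀ Y).2 (((hX₀ X).1 hX).trans h)

/-- Every extension has a realization whose middle differentials are in the radical. -/
lemma exists_mem_s_inRadical [HasZeroObject 𝒞] (hKS : IsKrullSchmidt 𝒞) {A B : 𝒞}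
    (δ : T.E.Ext B A) :
    ∃ X ∈ T.s δ, ∀ i j : ℤ, i + 1 = j → 1 ≤ i → j ≤ n → InRadical (X.K.d i j) := by
  -- Removing a contractible summand stays inside `𝔰(δ)` and lowers this count, so a realization of
  -- minimal size has radical middle differentials.
  let size : NComplex 𝒞 n A B → ℕ := fun X => ∑ j ∈ Finset.Icc (1 : ℤ) n, localLength (X.K.X j)
  obtain ⟨X₀, hX₀⟩ := T.exists_mem_s δ
  obtain ⟨X, hX, hmin⟩ := exists_minimalFor_of_wellFoundedLT (· ∈ T.s δ) size ⟨X₀, hX₀⟩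
  refine ⟨X, hX, ?_⟩
  rintro i _ rfl hi hin
  by_contra hrad
  obtain ⟨Y, hXY, hle, hlt⟩ := X.exists_htpyEquiv_of_not_inRadical hKS hi hin hrad
  have h1 : size Y < size X := Finset.sum_lt_sum (fun j _ => hle j)
    ⟨i, Finset.mem_Icc.2 ⟨hi, by omega⟩, hlt⟩
  exact absurd (hmin (T.mem_s_of_htpyEquiv hX hXY) h1.le) (not_le.2 h1)

section

variable {T} (hn : 1 ≤ n) {A B : 𝒞} {δ : T.E.Ext B A} {X : NComplex 𝒞 n A B} (hX : X ∈ T.s δ)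
include hn hX

/-- Combine `θ` and `δ` into `ρ ∈ 𝔼(S ⊞ B, A)` and take a good lift of `B ⟶ S ⊞ B`. Its mapping cone
realizes `X.first_* ρ = 0`, so the last map of the cone is a split epi. Pulling `ρ` back along `𝟙`,
written through the two components of that map, leaves only the part through `B`, because `Y.last`
kills `ρ`. Thus `ρ`, and with it `θ`, is a pullback of `δ`. -/
lemma exists_pull_eq_of_push_first {S : 𝒞} (θ : T.E.Ext S A) (h : T.E.push X.first θ = 0) :
    ∃ c : S ⟶ B, T.E.pull c δ = θ := by
  let ρ : T.E.Ext (S ⊞ B) A := T.E.pull biprod.fst θ + T.E.pull biprod.snd δ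
  have hinl : T.E.pull biprod.inl ρ = θ := by
    rw [map_add, ← LinearMap.comp_apply, ← LinearMap.comp_apply, ← T.pull_comp, ← T.pull_comp,
      biprod.inl_fst, biprod.inl_snd, T.pull_id]
    simp [T.pull_zero]
  have hinr : T.E.pull biprod.inr ρ = δ := by
    rw [map_add, ← LinearMap.comp_apply, ← LinearMap.comp_apply, ← T.pull_comp, ← T.pull_comp,
      biprod.inr_fst, biprod.inr_snd, T.pull_id]
    simp [T.pull_zero]
  obtain ⟨Y, hY⟩ := T.exists_mem_s ρ
  obtain ⟨f, ⟨-, hf⟩, M, ⟨φ, -, -, hM⟩, hMs⟩ :=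
    T.good_lift ρ biprod.inr X (by rw [hinr]; exact hX) Y hY
  have hzero : T.E.push X.first ρ = 0 := by
    rw [map_add, T.push_pull, T.push_pull, h, (T.isNExangle δ X hX).push_first, map_zero, map_zero, add_zero]
  obtain ⟨t, ht⟩ := (T.isNExangle _ M hMs).exact_to_last _ (𝟙 _) (by rw [hzero, map_zero])
  have hn' : 1 ≤ (n : ℤ) := by exact_mod_cast hn
  rw [hM hn', hf, ← Category.assoc] at ht
  generalize t ≫ (φ _ _ rfl hn' le_rfl).hom = t' at ht
  have hρ : T.E.pull (t' ≫ biprod.fst ≫ X.right.hom) δ = ρ := by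
    have h1 : t' = biprod.lift (t' ≫ biprod.fst) (t' ≫ biprod.snd) := by ext <;> simp
    rw [h1, biprod.lift_desc] at ht
    have h2 : T.E.pull (A := A) (𝟙 (S ⊞ B)) ρ = ρ := by rw [T.pull_id]; rfl
    rw [← ht, T.bilinear.pull_add] at h2
    simp only [LinearMap.add_apply] at h2
    rw [T.pull_comp (t' ≫ biprod.snd), LinearMap.comp_apply, (T.isNExangle ρ Y hY).pull_last,
      map_zero, add_zero, ← Category.assoc, T.pull_comp _ biprod.inr, LinearMap.comp_apply, hinr,
      Category.assoc] at h2
    exact h2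
  refine ⟨biprod.inl ≫ t' ≫ biprod.fst ≫ X.right.hom, ?_⟩
  rw [T.pull_comp, LinearMap.comp_apply, hρ, hinl]

/-- Dual argument, with the mapping cocone of a good lift of `S ⊞ A ⟶ A`, whose first map is a split
mono. -/
lemma exists_push_eq_of_pull_last {S : 𝒞} (θ : T.E.Ext B S) (h : T.E.pull X.last θ = 0) :
    ∃ c : A ⟶ S, T.E.push c δ = θ := by
  let ρ : T.E.Ext B (S ⊞ A) := T.E.push biprod.inl θ + T.E.push biprod.inr δ
  have hfst : T.E.push biprod.fst ρ = θ := by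
    rw [map_add, ← LinearMap.comp_apply, ← LinearMap.comp_apply, ← T.push_comp, ← T.push_comp,
      biprod.inl_fst, biprod.inr_fst, T.push_id]
    simp [T.push_zero]
  have hsnd : T.E.push biprod.snd ρ = δ := by
    rw [map_add, ← LinearMap.comp_apply, ← LinearMap.comp_apply, ← T.push_comp, ← T.push_comp,
      biprod.inl_snd, biprod.inr_snd, T.push_id]
    simp [T.push_zero]
  obtain ⟨Y, hY⟩ := T.exists_mem_s ρ
  obtain ⟨f, ⟨hf, -⟩, N, ⟨φ, hN, -, -⟩, hNs⟩ :=
    T.good_lift_op ρ biprod.snd Y hY X (by rw [hsnd]; exact hX)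
  have hzero : T.E.pull X.last ρ = 0 := by
    rw [map_add, ← T.push_pull, ← T.push_pull, h, (T.isNExangle δ X hX).pull_last, map_zero, map_zero, add_zero]
  obtain ⟨t, ht⟩ := (T.isNExangle _ N hNs).exact_from_first _ (𝟙 _) (by rw [hzero, map_zero])
  have hn' : 1 ≤ (n : ℤ) := by exact_mod_cast hn
  have hN1 : N.first = biprod.lift Y.first (Y.left.inv ≫ f.f 0) ≫ (φ 0 1 rfl le_rfl hn').inv := by
    rw [← hN hn', Category.assoc, Iso.hom_inv_id, Category.comp_id]
  have hf0 : Y.left.inv ≫ f.f 0 = biprod.snd ≫ X.left.inv := by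
    rw [Iso.inv_comp_eq, ← Category.assoc, ← hf, Category.assoc, Iso.hom_inv_id, Category.comp_id]
  rw [hN1, hf0, Category.assoc] at ht
  generalize (φ 0 1 rfl le_rfl hn').inv ≫ t = t' at ht
  have hρ : T.E.push (X.left.inv ≫ biprod.inr ≫ t') δ = ρ := by
    have h1 : t' = biprod.desc (biprod.inl ≫ t') (biprod.inr ≫ t') := by ext <;> simp
    rw [h1, biprod.lift_desc] at ht
    have h2 : T.E.push (B := B) (𝟙 (S ⊞ A)) ρ = ρ := by rw [T.push_id]; rfl
    rw [← ht, T.bilinear.push_add] at h2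
    simp only [LinearMap.add_apply] at h2
    rw [T.push_comp Y.first, LinearMap.comp_apply, (T.isNExangle ρ Y hY).push_first,
      map_zero, zero_add, Category.assoc, T.push_comp biprod.snd, LinearMap.comp_apply, hsnd] at h2
    exact h2
  refine ⟨(X.left.inv ≫ biprod.inr ≫ t') ≫ biprod.fst, ?_⟩
  rw [T.push_comp, LinearMap.comp_apply, hρ, hfst]

end

end NExangulated

/-! ### Auslander–Reiten `n`-exangles and representable functors -/

namespace NExangulated

variable {k : Type uk} [CommRing k] {𝒞 : Type u} [Category.{v} 𝒞] [Preadditive 𝒞]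
  [HasBinaryBiproducts 𝒞] [Linear k 𝒞] {n : ℕ} (T : NExangulated.{w} k 𝒞 n)

/-- The bifunctor of extensions of an `n`-exangulated category. -/
noncomputable def exactExt (hn : 1 ≤ n) : ExactExt.{w} k 𝒞 where
  Ext B A := T.E.Ext B A
  push a := T.E.push a
  pull b := T.E.pull b
  push_id θ := by rw [T.push_id]; rfl
  pull_id θ := by rw [T.pull_id]; rfl
  push_comp f g θ := by rw [T.push_comp]; rfl
  pull_comp f g θ := by rw [T.pull_comp]; rfl
  push_add f g θ := by rw [T.bilinear.push_add]; rfl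
  pull_add f g θ := by rw [T.bilinear.pull_add]; rfl
  push_pull := T.push_pull
  exists_push_eq_smul r A := ⟨r • 𝟙 A, fun B θ => by
    rw [T.bilinear.push_smul, T.push_id]; rfl⟩
  exists_pull_eq_smul r B := ⟨r • 𝟙 B, fun A θ => by
    rw [T.bilinear.pull_smul, T.pull_id]; rfl⟩
  exists_inflation δ := by
    obtain ⟨X, hX⟩ := T.exists_mem_s δ
    have h := T.isNExangle δ X hX
    exact ⟨_, X.first, h.push_first, h.exact_from_first,
      fun S θ => exists_pull_eq_of_push_first hn hX θ⟩
  exists_deflation δ := by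
    obtain ⟨X, hX⟩ := T.exists_mem_s δ
    have h := T.isNExangle δ X hX
    exact ⟨_, X.last, h.pull_last, h.exact_to_last,
      fun S θ => exists_push_eq_of_pull_last hn hX θ⟩

variable {T}

lemma isSplitMono_first_iff {A B : 𝒞} {δ : T.E.Ext B A} {X : NComplex 𝒞 n A B} (hX : X ∈ T.s δ) :
    IsSplitMono X.first ↔ δ = 0 := by
  have hE := T.isNExangle δ X hX
  constructor
  · intro h
    have h1 : T.E.push (B := B) (𝟙 A) δ = δ := by rw [T.push_id]; rfl
    rw [← h1, ← IsSplitMono.id X.first, T.push_comp, LinearMap.comp_apply, hE.push_first, map_zero]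
  · rintro rfl
    obtain ⟨h, hh⟩ := hE.exact_from_first _ (𝟙 A) (map_zero _)
    exact ⟨⟨⟨h, hh⟩⟩⟩

lemma isSplitEpi_last_iff {A B : 𝒞} {δ : T.E.Ext B A} {X : NComplex 𝒞 n A B} (hX : X ∈ T.s δ) :
    IsSplitEpi X.last ↔ δ = 0 := by
  have hE := T.isNExangle δ X hX
  constructor
  · intro h
    have h1 : T.E.pull (A := A) (𝟙 B) δ = δ := by rw [T.pull_id]; rfl
    rw [← h1, ← IsSplitEpi.id X.last, T.pull_comp, LinearMap.comp_apply, hE.pull_last, map_zero]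
  · rintro rfl
    obtain ⟨h, hh⟩ := hE.exact_to_last _ (𝟙 B) (map_zero _)
    exact ⟨⟨⟨h, hh⟩⟩⟩

/-- Used contrapositively: a non-projective `X` has a nonzero extension, from which the construction
of an almost split one starts. -/
lemma isProjective_of_forall_eq_zero {P : 𝒞} (h : ∀ (A : 𝒞) (δ : T.E.Ext P A), δ = 0) :
    T.IsProjective P :=
  fun _ _ δ X hX c => (T.isNExangle δ X hX).exact_to_last _ c (h _ _)

lemma isInjective_of_forall_eq_zero {I : 𝒞} (h : ∀ (B : 𝒞) (δ : T.E.Ext B I), δ = 0) :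
    T.IsInjective I :=
  fun _ _ δ X hX c => (T.isNExangle δ X hX).exact_from_first _ c (h _ _)

lemma IsAuslanderReiten.almostSplit (hn : 1 ≤ n) {A B : 𝒞} {δ : T.E.Ext B A}
    {X : NComplex 𝒞 n A B} (h : T.IsAuslanderReiten X δ) :
    (T.exactExt hn).AlmostSplit (B := B) (A := A) δ := by
  have hE := T.isNExangle δ X h.distinguished
  refine ⟨fun h0 => h.left_almost_split.1 ((isSplitMono_first_iff h.distinguished).2 h0),
    fun {S} g hg => ?_, fun {S} g hg => ?_⟩
  · obtain ⟨t, rfl⟩ := h.left_almost_split.2 _ g hg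
    change T.E.push _ δ = 0
    rw [T.push_comp, LinearMap.comp_apply, hE.push_first, map_zero]
  · obtain ⟨t, rfl⟩ := h.right_almost_split.2 _ g hg
    change T.E.pull _ δ = 0
    rw [T.pull_comp, LinearMap.comp_apply, hE.pull_last, map_zero]

/-- Exactness turns the vanishing of `g_* δ` or `g^* δ` into a factorization through an end
differential; the choice of a realization supplies the radical condition. -/
lemma exists_isAuslanderReiten [HasZeroObject 𝒞] (hKS : IsKrullSchmidt 𝒞) (hn : 1 ≤ n) {A B : 𝒞}
    {δ : T.E.Ext B A} (h : (T.exactExt hn).AlmostSplit (B := B) (A := A) δ) :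
    ∃ X : NComplex 𝒞 n A B, T.IsAuslanderReiten X δ := by
  obtain ⟨X, hX, hrad⟩ := T.exists_mem_s_inRadical hKS δ
  have hE := T.isNExangle δ X hX
  exact ⟨X, hX, ⟨fun hs => h.ne_zero ((isSplitMono_first_iff hX).1 hs),
    fun S g hg => hE.exact_from_first S g (h.push_eq_zero g hg)⟩,
    ⟨fun hs => h.ne_zero ((isSplitEpi_last_iff hX).1 hs),
    fun S g hg => hE.exact_to_last S g (h.pull_eq_zero g hg)⟩, hrad⟩

/-- `δ` is the sum of its images under the idempotents of a decomposition of `A`, so some projection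
does not kill it. -/
lemma exists_push_ne_zero (hKS : IsKrullSchmidt 𝒞) {X A : 𝒞} (δ : T.E.Ext X A) (hδ : δ ≠ 0) :
    ∃ (A' : 𝒞) (p : A ⟶ A'), HasLocalEnd A' ∧ T.E.push p δ ≠ 0 := by
  obtain ⟨m, ⟨D⟩⟩ := hKS.exists_localDecomp A
  by_contra! hc
  let F : (A ⟶ A) →+ T.E.Ext X A :=
    { toFun := fun f => T.E.push f δ
      map_zero' := by rw [T.push_zero]; rfl
      map_add' := fun f g => by rw [T.bilinear.push_add]; rfl }
  have h1 : F (𝟙 A) = δ := by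
    change T.E.push (𝟙 A) δ = δ
    rw [T.push_id]; rfl
  apply hδ
  rw [← h1, ← D.total, map_sum]
  refine Finset.sum_eq_zero fun i _ => ?_
  change T.E.push (D.π i ≫ D.ι i) δ = 0
  rw [T.push_comp, LinearMap.comp_apply, hc _ (D.π i) (D.hasLocalEnd i), map_zero]

lemma exists_pull_ne_zero (hKS : IsKrullSchmidt 𝒞) {X A : 𝒞} (δ : T.E.Ext X A) (hδ : δ ≠ 0) :
    ∃ (X' : 𝒞) (p : X' ⟶ X), HasLocalEnd X' ∧ T.E.pull p δ ≠ 0 := by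
  obtain ⟨m, ⟨D⟩⟩ := hKS.exists_localDecomp X
  by_contra! hc
  let F : (X ⟶ X) →+ T.E.Ext X A :=
    { toFun := fun f => T.E.pull f δ
      map_zero' := by rw [T.pull_zero]; rfl
      map_add' := fun f g => by rw [T.bilinear.pull_add]; rfl }
  have h1 : F (𝟙 X) = δ := by
    change T.E.pull (𝟙 X) δ = δ
    rw [T.pull_id]; rfl
  apply hδ
  rw [← h1, ← D.total, map_sum]
  refine Finset.sum_eq_zero fun i _ => ?_
  change T.E.pull (D.π i ≫ D.ι i) δ = 0
  rw [T.pull_comp, LinearMap.comp_apply, hc _ (D.ι i) (D.hasLocalEnd i), map_zero]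

variable {J : Type uk} [AddCommGroup J] [Module k J]

/-- Yoneda: a natural isomorphism is determined by the image `φ` of the identity. Its surjectivity
is `exists_eq` and its injectivity is `push_eq_zero`. -/
lemma memCr_iff (hn : 1 ≤ n) (X : 𝒞) : T.MemCr J X ↔
    ∃ (A : 𝒞) (φ : (T.exactExt hn).Ext X A →ₗ[k] J), (T.exactExt hn).Represents φ := by
  let Q := Quotient.functor T.injRel
  have hQ : ∀ {Y Z : 𝒞} (f : Y ⟶ Z), Q.map f = 0 ↔ T.InjTrivial f := by
    intro Y Z f
    rw [← Q.map_zero Y Z, Quotient.functor_map_eq_iff]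
    simp [injRel]
  constructor
  · rintro ⟨A, e, he⟩
    let φ : T.E.Ext X A.as →ₗ[k] J := e A (𝟙 A)
    have hφ : ∀ {Y : 𝒞} (f : Y ⟶ A.as),
        (e (Q.obj Y) (Q.map f) : T.E.Ext X Y →ₗ[k] J) = φ ∘ₗ T.E.push f := by
      intro Y f
      have := he (Y := Q.obj Y) (Z := A) (Q.map f) (𝟙 A)
      rw [Category.comp_id] at this
      exact this
    refine ⟨A.as, φ, fun {Y} ψ => ?_, fun {Y} f hf => ?_⟩
    · let ψ' : (T.costableDualExt J X).obj (op (Q.obj Y)) := ψ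
      obtain ⟨f, hf⟩ := Q.map_surjective ((e (Q.obj Y)).symm ψ')
      refine ⟨f, fun μ => ?_⟩
      have h1 : e (Q.obj Y) (Q.map f) = ψ' := by
        rw [hf, LinearEquiv.apply_symm_apply]
      exact LinearMap.congr_fun ((hφ f).symm.trans h1) μ
    · have h0 : Q.map f = 0 := by
        apply (e (Q.obj Y)).injective
        rw [map_zero]
        exact (hφ f).trans (LinearMap.ext hf)
      intro Z θ
      exact LinearMap.congr_fun ((hQ f).1 h0 Z) θ
  · rintro ⟨A, φ, h⟩
    let φ₀ : T.E.Ext X A →ₗ[k] J := φ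
    let φ' : (T.costableDualExt J X).obj (op (Q.obj A)) := φ
    have hadd : ∀ {Y : T.Costable} (g g' : Y ⟶ Q.obj A),
        (T.costableDualExt J X).map (g + g').op φ' =
          (T.costableDualExt J X).map g.op φ' + (T.costableDualExt J X).map g'.op φ' := by
      intro Y g g'
      obtain ⟨f, rfl⟩ := Q.map_surjective (X := Y.as) (Y := A) g
      obtain ⟨f', rfl⟩ := Q.map_surjective (X := Y.as) (Y := A) g'
      rw [← Q.map_add]
      change φ₀ ∘ₗ T.E.push (f + f') = φ₀ ∘ₗ T.E.push f + φ₀ ∘ₗ T.E.push f'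
      rw [T.bilinear.push_add, LinearMap.comp_add]
    have hsmul : ∀ {Y : T.Costable} (r : k) (g : Y ⟶ Q.obj A),
        (T.costableDualExt J X).map (r • g).op φ' = r • (T.costableDualExt J X).map g.op φ' := by
      intro Y r g
      obtain ⟨f, rfl⟩ := Q.map_surjective (X := Y.as) (Y := A) g
      change φ₀ ∘ₗ T.E.push (r • f) = r • (φ₀ ∘ₗ T.E.push f)
      rw [T.bilinear.push_smul, LinearMap.comp_smul]
    refine ⟨Q.obj A, fun Y => LinearEquiv.ofBijective
      { toFun := fun g => (T.costableDualExt J X).map g.op φ'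
        map_add' := hadd
        map_smul' := hsmul } ⟨?_, ?_⟩, fun {Y Z} f g => ?_⟩
    · rw [injective_iff_map_eq_zero]
      intro g hg
      obtain ⟨f, rfl⟩ := Q.map_surjective (X := Y.as) (Y := A) g
      exact (hQ f).2 fun Z => LinearMap.ext
        (h.push_eq_zero f (fun μ => LinearMap.congr_fun hg μ) Z)
    · intro ψ
      obtain ⟨f, hf⟩ := h.exists_eq (Y := Y.as) ψ
      exact ⟨Q.map f, LinearMap.ext hf⟩
    · change (T.costableDualExt J X).map (f ≫ g).op φ' = _
      rw [op_comp, Functor.map_comp]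
      rfl

lemma memCl_iff (hn : 1 ≤ n) (X : 𝒞) : T.MemCl J X ↔
    ∃ (A : 𝒞ᵒᵖ) (φ : (T.exactExt hn).op.Ext (op X) A →ₗ[k] J),
      (T.exactExt hn).op.Represents φ := by
  let Q := Quotient.functor T.projRel
  have hQ : ∀ {Y Z : 𝒞} (f : Y ⟶ Z), Q.map f = 0 ↔ T.ProjTrivial f := by
    intro Y Z f
    rw [← Q.map_zero Y Z, Quotient.functor_map_eq_iff]
    simp [projRel]
  constructor
  · rintro ⟨A, e, he⟩
    let φ : T.E.Ext A.as X →ₗ[k] J := e A (𝟙 A)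
    have hφ : ∀ {Y : 𝒞} (f : A.as ⟶ Y),
        (e (Q.obj Y) (Q.map f) : T.E.Ext Y X →ₗ[k] J) = φ ∘ₗ T.E.pull f := by
      intro Y f
      have := he (Y := A) (Z := Q.obj Y) (𝟙 A) (Q.map f)
      rw [Category.id_comp] at this
      exact this
    refine ⟨op A.as, φ, fun {Y} ψ => ?_, fun {Y} f hf => ?_⟩
    · let ψ' : (T.stableDualExt J X).obj (Q.obj Y.unop) := ψ
      obtain ⟨f, hf⟩ := Q.map_surjective ((e (Q.obj Y.unop)).symm ψ')
      refine ⟨f.op, fun μ => ?_⟩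
      have h1 : e (Q.obj Y.unop) (Q.map f) = ψ' := by
        rw [hf, LinearEquiv.apply_symm_apply]
      exact LinearMap.congr_fun ((hφ f).symm.trans h1) μ
    · have h0 : Q.map f.unop = 0 := by
        apply (e (Q.obj Y.unop)).injective
        rw [map_zero]
        exact (hφ f.unop).trans (LinearMap.ext hf)
      intro Z θ
      exact LinearMap.congr_fun ((hQ f.unop).1 h0 Z.unop) θ
  · rintro ⟨⟨A⟩, φ, h⟩
    let φ₀ : T.E.Ext A X →ₗ[k] J := φ
    let φ' : (T.stableDualExt J X).obj (Q.obj A) := φ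
    have hadd : ∀ {Y : T.Stable} (g g' : Q.obj A ⟶ Y),
        (T.stableDualExt J X).map (g + g') φ' =
          (T.stableDualExt J X).map g φ' + (T.stableDualExt J X).map g' φ' := by
      intro Y g g'
      obtain ⟨f, rfl⟩ := Q.map_surjective (X := A) (Y := Y.as) g
      obtain ⟨f', rfl⟩ := Q.map_surjective (X := A) (Y := Y.as) g'
      rw [← Q.map_add]
      change φ₀ ∘ₗ T.E.pull (f + f') = φ₀ ∘ₗ T.E.pull f + φ₀ ∘ₗ T.E.pull f'
      rw [T.bilinear.pull_add, LinearMap.comp_add]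
    have hsmul : ∀ {Y : T.Stable} (r : k) (g : Q.obj A ⟶ Y),
        (T.stableDualExt J X).map (r • g) φ' = r • (T.stableDualExt J X).map g φ' := by
      intro Y r g
      obtain ⟨f, rfl⟩ := Q.map_surjective (X := A) (Y := Y.as) g
      change φ₀ ∘ₗ T.E.pull (r • f) = r • (φ₀ ∘ₗ T.E.pull f)
      rw [T.bilinear.pull_smul, LinearMap.comp_smul]
    refine ⟨Q.obj A, fun Y => LinearEquiv.ofBijective
      { toFun := fun g => (T.stableDualExt J X).map g φ'
        map_add' := hadd
        map_smul' := hsmul } ⟨?_, ?_⟩, fun {Y Z} g f => ?_⟩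
    · rw [injective_iff_map_eq_zero]
      intro g hg
      obtain ⟨f, rfl⟩ := Q.map_surjective (X := A) (Y := Y.as) g
      exact (hQ f).2 fun Z => LinearMap.ext
        (h.push_eq_zero f.op (fun μ => LinearMap.congr_fun hg μ) (op Z))
    · intro ψ
      obtain ⟨f, hf⟩ := h.exists_eq (Y := op Y.as) ψ
      exact ⟨Q.map f.unop, LinearMap.ext hf⟩
    · change (T.stableDualExt J X).map (g ≫ f) φ' = _
      rw [Functor.map_comp]
      rfl

end NExangulated

/-- Here `J` is the minimal injective cogenerator for the finitely generated `k`-modules, used to form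
the duality `D = Hom_k(-, J)`. -/
theorem proposition3p7 {k : Type uk} [CommRing k] [IsArtinianRing k]
    (J : Type uk) [AddCommGroup J] [Module k J] (hJ : IsMinimalInjectiveCogenerator k J)
    {𝒞 : Type u} [Category.{v} 𝒞] [Preadditive 𝒞] [HasZeroObject 𝒞]
    [HasBinaryBiproducts 𝒞] [Linear k 𝒞]
    (n : ℕ) (hn : 1 ≤ n) (T : NExangulated.{w} k 𝒞 n)
    (hKS : IsKrullSchmidt 𝒞) (hfin : T.IsExtFinite)
    (X : 𝒞) (hX : Indecomposable X) :
    (¬ T.IsProjective X →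
      (T.MemCr J X ↔
        ∃ (A : 𝒞) (δ : T.E.Ext X A) (Y : NComplex 𝒞 n A X), T.IsAuslanderReiten Y δ)) ∧
    (¬ T.IsInjective X →
      (T.MemCl J X ↔
        ∃ (B : 𝒞) (δ : T.E.Ext B X) (Y : NComplex 𝒞 n X B), T.IsAuslanderReiten Y δ)) := by
  have hloc := hasLocalEnd_of_indecomposable hKS hX
  refine ⟨fun hP => ?_, fun hI => ?_⟩
  · refine (NExangulated.memCr_iff hn X).trans
      (((T.exactExt hn).exists_represents_iff_exists_almostSplit hJ hfin
      (fun δ hδ => NExangulated.exists_push_ne_zero hKS δ hδ) hloc (by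
        by_contra! hc
        exact hP (NExangulated.isProjective_of_forall_eq_zero hc))).trans ?_)
    exact ⟨fun ⟨A, δ, h⟩ => ⟨A, δ, NExangulated.exists_isAuslanderReiten hKS hn h⟩,
      fun ⟨A, δ, Y, h⟩ => ⟨A, δ, h.almostSplit hn⟩⟩
  -- The same criterion is applied to the opposite bifunctor, with pullbacks and pushforwards
  -- exchanged.
  · refine (NExangulated.memCl_iff hn X).trans
      (((T.exactExt hn).op.exists_represents_iff_exists_almostSplit hJ
        (fun A B => hfin B.unop A.unop)
        (fun δ hδ => by
          obtain ⟨X', p, h1, h2⟩ := NExangulated.exists_pull_ne_zero hKS δ hδ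
          exact ⟨op X', p.op, h1.op, h2⟩) hloc.op (by
        by_contra! hc
        exact hI (NExangulated.isInjective_of_forall_eq_zero fun B δ => hc (op B) δ))).trans ?_)
    exact ⟨fun ⟨A, δ, h⟩ => ⟨A.unop, δ, NExangulated.exists_isAuslanderReiten hKS hn
        (((T.exactExt hn).almostSplit_op_iff δ).1 h)⟩,
      fun ⟨A, δ, Y, h⟩ => ⟨op A, δ, ((T.exactExt hn).almostSplit_op_iff δ).2 (h.almostSplit hn)⟩⟩
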